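/- Let $s\ge 3$ and consider the three-component Camassa--Holm system on $\mathbb R$ $$\begin{cases} m_t+m_xu+2mu_x+(mv+mw)_x+nv_x+lw_x=0,\\ n_t+n_xv+2nv_x+(nu+nw)_x+mu_x+lw_x=0,\\ l_t+l_xw+2lw_x+(lu+lv)_x+mu_x+nv_x=0,\end{cases}$$ where $m=u-u_{xx}$, $n=v-v_{xx}$, $l=w-w_{xx}$. Let $T\in(0,\infty]$ and let $(u,v,w)\in C([0,T);H^s(\mathbb R))^3\cap C^1([0,T);H^{s-1}(\mathbb R))^3$ be a real-valued strong solution on $[0,T)$ with initial data $(u_0,v_0,w_0)\in H^s(\mathbb R)^3$ (in particular, $T$ may be the maximal existence time). Write $m_0=u_0-u_{0xx}$, $n_0=v_0-v_{0xx}$, $l_0=w_0-w_{0xx}$, let $\lambda\ge 0$, and let $\|(f,g,h)\|_{L^q}=\|f\|_{L^q}+\|g\|_{L^q}+\|h\|_{L^q}$. (i) For every $T'\in[0,T)$ there is a constant $K\ge 0$ such that for all real $p\ge 1$ and all $C$: if $$\|(m_0,n_0,l_0)\,e^{(1+\lambda)|x|}\|_{L^{2p}}\le C,$$ then $\|(m,n,l)(t,\cdot)\,e^{(1+\lambda)|x|}\|_{L^{2p}}\le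 K\,C$ for all $t\in[0,T']$. In particular, the weighted norm remains finite for all $t\in[0,T)$. (ii) Suppose that $\partial_x^ju_0,\ \partial_x^jv_0,\ \partial_x^jw_0=O(e^{-(1+\lambda)|x|})$ as $|x|\to\infty$ for $j=0,1,2$. Then, for every $T'\in[0,T)$, uniformly for $t\in[0,T']$, $$m(t,x),\ n(t,x),\ l(t,x)=O(e^{-(1+\lambda)|x|})\quad\text{as }|x|\to\infty,$$ and, for every $\alpha\in(0,1)$ and $j=0,1,2$, $$\partial_x^ju(t,x),\ \partial_x^jv(t,x),\ \partial_x^jw(t,x)=O(e^{-\alpha|x|})\quad\text{as }|x|\to\infty.$$ -/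

import Mathlib

open MeasureTheory Filter Set Asymptotics
open scoped FourierTransform

noncomputable section

namespace ThreeCH

/-- `F` is the function `ξ ↦ (1 + |2πξ|²)^{s/2} 𝓕f(ξ)`, where `𝓕` is the Fourier-Plancherel transform
on `L²(ℝ)` with kernel `e^{-2πixξ}` (so that `1 + |2πξ|²` is the symbol of `1 - ∂ₓ²`).
For `s ≥ 0`, the real function `f` lies in `H^s(ℝ)` iff such an `F ∈ L²` exists, and then
`‖f‖_{H^s} = ‖F‖_{L²}`; `f ↦ F` is a linear isometry from `H^s` into `L²`. -/
def IsSobolevTransform (s : ℝ) (f : ℝ → ℝ) (F : Lp ℂ 2 (volume : Measure ℝ)) : Prop :=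
  ∃ hf : MemLp (fun x : ℝ => (f x : ℂ)) 2 (volume : Measure ℝ),
    (F : ℝ → ℂ) =ᵐ[volume] fun ξ : ℝ =>
      (((1 + (2 * Real.pi * ξ) ^ 2) ^ (s / 2) : ℝ) : ℂ) *
        (𝓕 (hf.toLp (fun x : ℝ => (f x : ℂ))) : Lp ℂ 2 (volume : Measure ℝ)) ξ

/-- `u ∈ C(I; H^s)`: every `u t`, `t ∈ I`, is in `H^s`, and `t ↦ u t` is continuous on `I` for the
norm of `H^s`. -/
def ContinuousInHs (s : ℝ) (I : Set ℝ) (u : ℝ → ℝ → ℝ) : Prop :=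
  ∃ F : ℝ → Lp ℂ 2 (volume : Measure ℝ),
    (∀ t ∈ I, IsSobolevTransform s (u t) (F t)) ∧ ContinuousOn F I

/-- `u ∈ C¹(I; H^s)` with time derivative `u'`: for the norm of `H^s`, the map `t ↦ u t` has the
derivative `u' t` at every `t ∈ I` (one-sided at an endpoint), and `t ↦ u' t` is continuous. -/
def HasContinuousDerivInHs (s : ℝ) (I : Set ℝ) (u u' : ℝ → ℝ → ℝ) : Prop :=
  ∃ F F' : ℝ → Lp ℂ 2 (volume : Measure ℝ),
    (∀ t ∈ I, IsSobolevTransform s (u t) (F t)) ∧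
    (∀ t ∈ I, IsSobolevTransform s (u' t) (F' t)) ∧
    (∀ t ∈ I, HasDerivWithinAt F (F' t) I t) ∧ ContinuousOn F' I

/-- `u ∈ C(I; H^s) ∩ C¹(I; H^{s-1})` with time derivative `u'`. Elements of Sobolev spaces of order
`> 1/2` are identified with their continuous representatives; for `s ≥ 3` the function `u t` is then
of class `C²`, and `u' t` is of class `C¹`. -/
structure InStrongClass (s : ℝ) (I : Set ℝ) (u u' : ℝ → ℝ → ℝ) : Prop where
  continuous_rep : ∀ t ∈ I, Continuous (u t)
  continuous_rep_deriv : ∀ t ∈ I, Continuous (u' t)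
  continuousInHs : ContinuousInHs s I u
  hasDerivInHs : HasContinuousDerivInHs (s - 1) I u u'

/-- The potential `f - f_xx`. -/
def potential (f : ℝ → ℝ) (x : ℝ) : ℝ := f x - deriv (deriv f) x

/-- The time interval `[0, T)`, with `T ∈ (0, ∞]`. -/
def timeInterval (T : EReal) : Set ℝ := {t : ℝ | 0 ≤ t ∧ (t : EReal) < T}

/-- One equation of the three-component Camassa-Holm system at a fixed time,
`m_t + m_x u + 2 m u_x + (m v + m w)_x + n v_x + l w_x = 0` almost everywhere on `ℝ`, with
`m = u - u_xx`, `n = v - v_xx`, `l = w - w_xx` and `m_t = u_t - u_txx`, where `ut` is `u_t`.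
For `u, v, w ∈ H³` and `u_t ∈ H²` the functions `m`, `m v + m w` and `∂ₓ u_t` are locally absolutely
continuous, so their classical derivatives exist almost everywhere and are the weak ones, and the
left side is an element of `L²`. -/
def SatisfiesEquation (u v w ut : ℝ → ℝ) : Prop :=
  ∀ᵐ x : ℝ, potential ut x + deriv (potential u) x * u x + 2 * potential u x * deriv u x
    + deriv (fun y => potential u y * v y + potential u y * w y) x
    + potential v x * deriv v x + potential w x * deriv w x = 0

/-- `(u, v, w) ∈ C([0,T); H^s)³ ∩ C¹([0,T); H^{s-1})³` is a strong solution, on `[0, T)`, of the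
three-component Camassa-Holm system with initial data `(u₀, v₀, w₀)` (which is then in `H^s`). -/
def IsStrongSolution (s : ℝ) (T : EReal) (u₀ v₀ w₀ : ℝ → ℝ) (u v w : ℝ → ℝ → ℝ) : Prop :=
  (u 0 = u₀ ∧ v 0 = v₀ ∧ w 0 = w₀) ∧
  ∃ u' v' w' : ℝ → ℝ → ℝ,
    InStrongClass s (timeInterval T) u u' ∧
    InStrongClass s (timeInterval T) v v' ∧
    InStrongClass s (timeInterval T) w w' ∧
    ∀ t ∈ timeInterval T,
      SatisfiesEquation (u t) (v t) (w t) (u' t) ∧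
      SatisfiesEquation (v t) (u t) (w t) (v' t) ∧
      SatisfiesEquation (w t) (u t) (v t) (w' t)

/-- `‖(m, n, l) e^{(1+lam)|x|}‖_{L^q}`, the sum of the norms of the three components. -/
def weightedNorm (lam q : ℝ) (m n l : ℝ → ℝ) : ENNReal :=
  eLpNorm (fun x => m x * Real.exp ((1 + lam) * |x|)) (ENNReal.ofReal q) volume +
  eLpNorm (fun x => n x * Real.exp ((1 + lam) * |x|)) (ENNReal.ofReal q) volume +
  eLpNorm (fun x => l x * Real.exp ((1 + lam) * |x|)) (ENNReal.ofReal q) volume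

/-- `f(x) = O(e^{-a|x|})` as `|x| → ∞`. -/
def ExpDecay (a : ℝ) (f : ℝ → ℝ) : Prop :=
  f =O[cocompact ℝ] fun x => Real.exp (-(a * |x|))

/-- `f(t, x) = O(e^{-a|x|})` as `|x| → ∞`, uniformly for `t ∈ [0, T']`. -/
def UniformExpDecay (a T' : ℝ) (f : ℝ → ℝ → ℝ) : Prop :=
  (fun q : ℝ × ℝ => f q.1 q.2) =O[𝓟 (Icc 0 T') ×ˢ cocompact ℝ]
    fun q : ℝ × ℝ => Real.exp (-(a * |q.2|))

end ThreeCH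

end

open scoped Topology

noncomputable section

namespace ThreeCH

/-! The system is local in the potentials. Its first equation reads `m_t = -(u+v+w) m_x - m
(2u_x+v_x+w_x) - n v_x - l w_x`, a transport equation with a zero-order coupling, and the other two
have the same form. On `[0, T']` the coefficients and the potentials are bounded by one `B`, because
`H³` controls `f`, `f'`, `f''` uniformly and `[0, T']` is compact.

Put `a = 1 + lam` and `q = 2p`. For a weight `ρ` with `|ρ'| ≤ q a ρ`, differentiate `∫ (|m|^q +
|n|^q + |l|^q) ρ` in time and integrate the transport term by parts; the outcome is `E' ≤ q B (11 +
3a) E` (`IsStrongSolution.exists_energy_le`). The growth rate is linear in `q`, so a `q`-th root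
leaves a factor independent of `q`. Hence one `K` serves all `p`, and `q → ∞` gives pointwise
bounds.

The weight `e^{q a |x|}` itself need not give a finite energy, so it is replaced by `exp (q * tent a
N x)`, which agrees with it on `[-N, N]` and decays beyond with the same logarithmic slope. No
constant in the differential inequality depends on `N`. For (i), Fatou's lemma lets `N → ∞`. For
(ii), initial data that are only `O(e^{-a|x|})` have tent energy at most `C^q` times a number
depending on `N` alone; that number disappears in the `q`-th root, and `N = |x|` gives the bound at
`x`.

Decay of `u` and `u_x` follows from that of `m` by factoring `1 - ∂² = (1 - ∂)(1 + ∂)` and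
integrating each first-order factor along a half-line (`half_line_decay`); then `u_xx = u - m`.

The analytic groundwork translates Sobolev regularity on the Fourier side into classical facts:
absolute continuity in `x`, sup bounds, and differentiability in `t` with values in `L²`. -/

/-! ### Multiplication by `2πiξ` and weak derivatives in `L²`. -/

theorem schwartz_integral_fourierInv (φ ψ : SchwartzMap ℝ ℂ)
    (h : ∀ ξ, ψ ξ = 2 * Real.pi * Complex.I * ξ * φ ξ) (a b : ℝ) :
    ∫ x in a..b, (𝓕⁻ ψ : SchwartzMap ℝ ℂ) x =
      (𝓕⁻ φ : SchwartzMap ℝ ℂ) b - (𝓕⁻ φ : SchwartzMap ℝ ℂ) a := by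
  have key : ∀ x, HasDerivAt (𝓕⁻ φ : SchwartzMap ℝ ℂ) ((𝓕⁻ ψ : SchwartzMap ℝ ℂ) x) x := by
    intro x
    have h1 := SchwartzMap.lineDerivOp_fourierInv_eq φ (1 : ℝ)
    have h2 : (2 * Real.pi * Complex.I) • SchwartzMap.smulLeftCLM ℂ (inner ℝ · (1:ℝ)) φ = ψ := by
      ext ξ
      have hg : (fun x : ℝ => inner ℝ x (1:ℝ)).HasTemperateGrowth := by fun_prop
      rw [smul_apply, SchwartzMap.smulLeftCLM_apply_apply hg, h]
      simp
      ring
    rw [h2] at h1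
    have hd := (𝓕⁻ φ : SchwartzMap ℝ ℂ).differentiableAt (x := x)
    rw [← h1, SchwartzMap.lineDerivOp_apply, hd.lineDeriv_eq_fderiv, fderiv_eq_smul_deriv, one_smul]
    exact hd.hasDerivAt
  refine intervalIntegral.integral_eq_sub_of_hasDerivAt (fun x _ => key x) ?_
  exact (SchwartzMap.continuous _).intervalIntegrable _ _

/-- An integral over a bounded interval is an `L²` pairing with an indicator function, hence
continuous in `L²`. -/
theorem tendsto_intervalIntegral_of_tendsto_L2 {ι : Type*} {l : Filter ι}
    {f : ι → Lp ℂ 2 (volume : Measure ℝ)} {g : Lp ℂ 2 (volume : Measure ℝ)}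
    (h : Tendsto f l (𝓝 g)) (a b : ℝ) :
    Tendsto (fun i => ∫ x in a..b, f i x) l (𝓝 (∫ x in a..b, g x)) := by
  have key : ∀ s : Set ℝ, MeasurableSet s → volume s ≠ ⊤ →
      Tendsto (fun i => ∫ x in s, f i x) l (𝓝 (∫ x in s, g x)) := by
    intro s hs hμ
    simp_rw [← L2.inner_indicatorConstLp_one (𝕜 := ℂ) hs hμ]
    exact tendsto_const_nhds.inner h
  simp only [intervalIntegral]
  exact (key _ measurableSet_Ioc (by simp)).sub (key _ measurableSet_Ioc (by simp))

theorem norm_Lp_le_of_ae_le {E : Type*} [NormedAddCommGroup E] {f : Lp E 2 (volume : Measure ℝ)}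
    {G : Type*} [NormedAddCommGroup G] {g : Lp G 2 (volume : Measure ℝ)} {c : ℝ}
    (h : ∀ᵐ x, ‖f x‖ ≤ c * ‖g x‖) : ‖f‖ ≤ c * ‖g‖ :=
  Lp.norm_le_mul_norm_of_ae_le_mul h

/-- Density of Schwartz functions, with `k` and `ξ k` approximated simultaneously. The integral
passes to the limit by `L²` convergence, the endpoint values only along an almost everywhere
convergent subsequence; this is why the endpoints are generic. -/
theorem L2_fourierInv_sub_ae_eq_integral {k j : Lp ℂ 2 (volume : Measure ℝ)}
    (hj : j =ᵐ[volume] fun ξ => 2 * Real.pi * Complex.I * ξ * k ξ) :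
    ∀ᵐ a, ∀ᵐ b, ∫ x in a..b, (𝓕⁻ j : Lp ℂ 2 (volume : Measure ℝ)) x =
      (𝓕⁻ k : Lp ℂ 2 (volume : Measure ℝ)) b - (𝓕⁻ k : Lp ℂ 2 (volume : Measure ℝ)) a := by
  -- Since `k` and `ξ k` are in `L²`, so is `k / w`. Approximating `k / w` by `φ n` makes `w * φ n →
  -- k` and `2πiξ * w * φ n → j`, because `w` and `ξ w` are bounded.
  let w : ℝ → ℝ := fun ξ => (1 + ‖ξ‖ ^ 2) ^ ((-1 / 2 : ℝ))
  have hw : w.HasTemperateGrowth := by fun_prop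
  have hw0 : ∀ ξ, 0 < w ξ := fun ξ => by positivity
  have hw1 : ∀ ξ, w ξ ≤ 1 := fun ξ =>
    Real.rpow_le_one_of_one_le_of_nonpos (by nlinarith [norm_nonneg ξ]) (by norm_num)
  have hwsq : ∀ ξ, w ξ ^ 2 * (1 + ξ ^ 2) = 1 := by
    intro ξ
    have : (0:ℝ) < 1 + ‖ξ‖ ^ 2 := by positivity
    simp only [w]
    rw [← Real.rpow_natCast, ← Real.rpow_mul this.le]
    norm_num
    rw [Real.rpow_neg_one, inv_mul_cancel₀ (by positivity)]
  have hwξ : ∀ ξ, |ξ| * w ξ ≤ 1 := by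
    intro ξ
    rw [← abs_of_pos (hw0 ξ), ← abs_mul]
    apply abs_le_one_iff_mul_self_le_one.mpr
    nlinarith [hwsq ξ, sq_nonneg (w ξ)]
  have hwinv : ∀ ξ, (w ξ)⁻¹ ≤ 1 + |ξ| := by
    intro ξ
    rw [inv_le_iff_one_le_mul₀ (hw0 ξ)]
    have h1 : 0 ≤ (1 + |ξ|) * w ξ := by have := hw0 ξ; positivity
    have := hwsq ξ
    have h2 : 1 ≤ ((1 + |ξ|) * w ξ) ^ 2 := by
      rw [← sq_abs ξ] at this
      nlinarith [mul_nonneg (abs_nonneg ξ) (sq_nonneg (w ξ))]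
    nlinarith
  have hwc : Continuous w := hw.1.continuous
  have hKmem : MemLp (fun ξ => ((w ξ)⁻¹ : ℂ) * k ξ) 2 volume := by
    refine MemLp.of_le (g := fun ξ => ‖k ξ‖ + ‖j ξ‖) ((Lp.memLp k).norm.add (Lp.memLp j).norm) ?_ ?_
    · refine (Continuous.aestronglyMeasurable ?_).mul (Lp.aestronglyMeasurable k)
      exact (Complex.continuous_ofReal.comp hwc).inv₀
        (fun ξ => Complex.ofReal_ne_zero.mpr (hw0 ξ).ne')
    · filter_upwards [hj] with ξ hξ
      rw [hξ]
      simp only [norm_mul, norm_inv, Complex.norm_real, Complex.norm_I, Complex.norm_ofNat,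
        Real.norm_eq_abs]
      rw [abs_of_pos (hw0 ξ), abs_of_pos Real.pi_pos, abs_of_nonneg (by positivity)]
      have h1 : (w ξ)⁻¹ * ‖k ξ‖ ≤ (1 + |ξ|) * ‖k ξ‖ := by gcongr; exact hwinv ξ
      nlinarith [Real.pi_gt_three, mul_nonneg (abs_nonneg ξ) (norm_nonneg (k ξ))]
  obtain ⟨φ, hφ⟩ : ∃ φ : ℕ → SchwartzMap ℝ ℂ,
      Tendsto (fun n => (φ n).toLp 2 volume) atTop (𝓝 (hKmem.toLp _)) := by
    have hd := SchwartzMap.denseRange_toLpCLM (E := ℝ) (F := ℂ) (μ := volume) (p := 2)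
      ENNReal.ofNat_ne_top
    obtain ⟨x, hx, hx2⟩ := mem_closure_iff_seq_limit.mp (hd (hKmem.toLp _))
    choose φ hφ using hx
    have hx' : x = fun n => (φ n).toLp 2 volume := funext fun n => (hφ n).symm
    exact ⟨φ, hx' ▸ hx2⟩
  let ψ : ℕ → SchwartzMap ℝ ℂ := fun n => SchwartzMap.smulLeftCLM ℂ w (φ n)
  have hi : (fun ξ : ℝ => ξ).HasTemperateGrowth := by fun_prop
  let η : ℕ → SchwartzMap ℝ ℂ := fun n =>
    (2 * Real.pi * Complex.I) • SchwartzMap.smulLeftCLM ℂ (fun ξ : ℝ => ξ) (ψ n)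
  have hψa : ∀ n ξ, ψ n ξ = w ξ * φ n ξ := fun n ξ => by
    simp [ψ, SchwartzMap.smulLeftCLM_apply_apply hw]
  have hηa : ∀ n ξ, η n ξ = 2 * Real.pi * Complex.I * ξ * ψ n ξ := fun n ξ => by
    simp only [η, smul_apply, SchwartzMap.smulLeftCLM_apply_apply hi]
    simp; ring
  have hψ : Tendsto (fun n => (ψ n).toLp 2 volume) atTop (𝓝 k) := by
    rw [tendsto_iff_norm_sub_tendsto_zero] at hφ ⊢
    refine squeeze_zero (fun n => norm_nonneg _) (fun n => ?_) hφ
    rw [← one_mul ‖(φ n).toLp 2 volume - _‖]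
    refine norm_Lp_le_of_ae_le ?_
    filter_upwards [Lp.coeFn_sub ((ψ n).toLp 2 volume) k, (ψ n).coeFn_toLp 2 volume,
      Lp.coeFn_sub ((φ n).toLp 2 volume) (hKmem.toLp _), (φ n).coeFn_toLp 2 volume,
      hKmem.coeFn_toLp] with ξ h1 h2 h3 h4 h5
    rw [h1, h3, Pi.sub_apply, Pi.sub_apply, h2, h4, h5, hψa, one_mul]
    have h0 : (w ξ : ℂ) ≠ 0 := by exact_mod_cast (hw0 ξ).ne'
    have : (w ξ : ℂ) * φ n ξ - k ξ = w ξ * (φ n ξ - (w ξ : ℂ)⁻¹ * k ξ) := by field_simp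
    rw [this, norm_mul, Complex.norm_real, Real.norm_eq_abs, abs_of_pos (hw0 ξ)]
    exact mul_le_of_le_one_left (norm_nonneg _) (hw1 ξ)
  have hη : Tendsto (fun n => (η n).toLp 2 volume) atTop (𝓝 j) := by
    rw [tendsto_iff_norm_sub_tendsto_zero] at hφ ⊢
    refine squeeze_zero (fun n => norm_nonneg _) (fun n => ?_)
      (by simpa using hφ.const_mul (2 * Real.pi))
    refine norm_Lp_le_of_ae_le ?_
    filter_upwards [Lp.coeFn_sub ((η n).toLp 2 volume) j, (η n).coeFn_toLp 2 volume,
      Lp.coeFn_sub ((φ n).toLp 2 volume) (hKmem.toLp _), (φ n).coeFn_toLp 2 volume,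
      hKmem.coeFn_toLp, hj] with ξ h1 h2 h3 h4 h5 h6
    rw [h1, h3, Pi.sub_apply, Pi.sub_apply, h2, h4, h5, hηa, hψa, h6]
    have h0 : (w ξ : ℂ) ≠ 0 := by exact_mod_cast (hw0 ξ).ne'
    have : 2 * Real.pi * Complex.I * ξ * (w ξ * φ n ξ) - 2 * Real.pi * Complex.I * ξ * k ξ
      = 2 * Real.pi * Complex.I * ξ * w ξ * (φ n ξ - (w ξ : ℂ)⁻¹ * k ξ) := by field_simp
    rw [this, norm_mul]
    refine mul_le_mul_of_nonneg_right ?_ (norm_nonneg _)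
    simp only [norm_mul, Complex.norm_real, Complex.norm_I, Complex.norm_ofNat, Real.norm_eq_abs]
    rw [abs_of_pos (hw0 ξ), abs_of_pos Real.pi_pos]
    nlinarith [hwξ ξ, Real.pi_pos]
  have hψ' := ((Lp.fourierTransformₗᵢ ℝ ℂ).symm.continuous.tendsto k).comp hψ
  have hη' := ((Lp.fourierTransformₗᵢ ℝ ℂ).symm.continuous.tendsto j).comp hη
  have eψ : ∀ n, (Lp.fourierTransformₗᵢ ℝ ℂ).symm ((ψ n).toLp 2 volume)
      = (𝓕⁻ (ψ n) : SchwartzMap ℝ ℂ).toLp 2 volume := fun n => SchwartzMap.toLp_fourierInv_eq _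
  have eη : ∀ n, (Lp.fourierTransformₗᵢ ℝ ℂ).symm ((η n).toLp 2 volume)
      = (𝓕⁻ (η n) : SchwartzMap ℝ ℂ).toLp 2 volume := fun n => SchwartzMap.toLp_fourierInv_eq _
  simp only [Function.comp_def, eψ] at hψ'
  simp only [Function.comp_def, eη] at hη'
  obtain ⟨ns, hns, hae⟩ := (tendstoInMeasure_of_tendsto_Lp hψ').exists_seq_tendsto_ae
  have hae2 : ∀ᵐ x, Tendsto (fun i => (𝓕⁻ (ψ (ns i)) : SchwartzMap ℝ ℂ) x) atTop
      (𝓝 ((𝓕⁻ k : Lp ℂ 2 (volume : Measure ℝ)) x)) := by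
    have := ae_all_iff.mpr fun n => (𝓕⁻ (ψ n) : SchwartzMap ℝ ℂ).coeFn_toLp 2 volume
    filter_upwards [hae, this] with x h1 h2
    simp only [h2] at h1
    exact h1
  filter_upwards [hae2] with a ha
  filter_upwards [hae2] with b hb
  have hint := (tendsto_intervalIntegral_of_tendsto_L2 hη' a b).comp hns.tendsto_atTop
  refine tendsto_nhds_unique hint ?_
  refine (hb.sub ha).congr fun i => ?_
  rw [← schwartz_integral_fourierInv _ _ (hηa (ns i)) a b]
  refine intervalIntegral.integral_congr_ae ?_
  filter_upwards [(𝓕⁻ (η (ns i)) : SchwartzMap ℝ ℂ).coeFn_toLp 2 volume] with x hx _ using hx.symm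

/-! ### Locally absolutely continuous primitives. -/

/-- `f` is a (locally absolutely continuous) primitive of the locally integrable function `g`. -/
structure IsPrimitive (f g : ℝ → ℝ) : Prop where
  locallyIntegrable : LocallyIntegrable g volume
  integral_eq : ∀ a b, ∫ x in a..b, g x = f b - f a

namespace IsPrimitive

variable {f g : ℝ → ℝ}

theorem intervalIntegrable (h : IsPrimitive f g) (a b : ℝ) : IntervalIntegrable g volume a b :=
  intervalIntegrable_iff.mpr <|
    (h.locallyIntegrable.integrableOn_isCompact isCompact_uIcc).mono_set uIoc_subset_uIcc

theorem eq_add_integral (h : IsPrimitive f g) (a : ℝ) : f = fun b => f a + ∫ x in a..b, g x := by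
  funext b
  rw [h.integral_eq]; ring

theorem continuous (h : IsPrimitive f g) : Continuous f := by
  rw [h.eq_add_integral 0]
  exact continuous_const.add (intervalIntegral.continuous_primitive h.intervalIntegrable 0)

theorem ae_hasDerivAt (h : IsPrimitive f g) : ∀ᵐ x, HasDerivAt f (g x) x := by
  filter_upwards [_root_.LocallyIntegrable.ae_hasDerivAt_integral h.locallyIntegrable] with x hx
  rw [h.eq_add_integral 0]
  exact (hx 0).const_add _

theorem ae_deriv_eq (h : IsPrimitive f g) : deriv f =ᵐ[volume] g := by
  filter_upwards [h.ae_hasDerivAt] with x hx using hx.deriv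

theorem hasDerivAt (h : IsPrimitive f g) (hg : Continuous g) (x : ℝ) : HasDerivAt f (g x) x := by
  rw [h.eq_add_integral 0]
  exact (intervalIntegral.integral_hasDerivAt_right (h.intervalIntegrable _ _)
    hg.aestronglyMeasurable.stronglyMeasurableAtFilter hg.continuousAt).const_add _

theorem absolutelyContinuousOnInterval (h : IsPrimitive f g) (a b : ℝ) :
    AbsolutelyContinuousOnInterval f a b := by
  have hc : AbsolutelyContinuousOnInterval (fun _ : ℝ => f a) a b :=
    (LipschitzWith.const (f a)).lipschitzOnWith.absolutelyContinuousOnInterval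
  rw [h.eq_add_integral a]
  exact hc.add ((h.intervalIntegrable a b).absolutelyContinuousOnInterval_intervalIntegral
    left_mem_uIcc)

theorem congr_right {g' : ℝ → ℝ} (h : IsPrimitive f g) (hg : g =ᵐ[volume] g') :
    IsPrimitive f g' where
  locallyIntegrable := h.locallyIntegrable.congr hg
  integral_eq a b := by
    rw [← h.integral_eq a b]
    exact intervalIntegral.integral_congr_ae (hg.mono fun x hx _ => hx.symm)

theorem sub {f' g' : ℝ → ℝ} (h : IsPrimitive f g) (h' : IsPrimitive f' g') :
    IsPrimitive (fun x => f x - f' x) (fun x => g x - g' x) where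
  locallyIntegrable := h.locallyIntegrable.sub h'.locallyIntegrable
  integral_eq a b := by
    rw [intervalIntegral.integral_sub (h.intervalIntegrable a b) (h'.intervalIntegrable a b),
      h.integral_eq, h'.integral_eq]
    ring

end IsPrimitive

/-! ### Classical regularity and sup bounds from Sobolev regularity. -/

section Sobolev

variable {σ : ℝ} {f : ℝ → ℝ} {F : Lp ℂ 2 (volume : Measure ℝ)}

theorem IsSobolevTransform.congr {g : ℝ → ℝ} (h : IsSobolevTransform σ f F)
    (hfg : f =ᵐ[volume] g) : IsSobolevTransform σ g F := by
  obtain ⟨hf, hF⟩ := h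
  have hae : (fun x => (f x : ℂ)) =ᵐ[volume] fun x => (g x : ℂ) := by
    filter_upwards [hfg] with x hx; rw [hx]
  refine ⟨hf.ae_eq hae, ?_⟩
  rwa [← (MemLp.toLp_eq_toLp_iff hf (hf.ae_eq hae)).mpr hae]

theorem locallyIntegrable_of_L2 (G : Lp ℂ 2 (volume : Measure ℝ)) :
    LocallyIntegrable G volume := (Lp.memLp G).locallyIntegrable (by norm_num)

theorem one_le_bessel (ξ : ℝ) : 1 ≤ 1 + (2 * Real.pi * ξ) ^ 2 := by nlinarith [sq_nonneg (2 * Real.pi * ξ)]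

theorem bessel_mul_le (σ ξ : ℝ) : (1 + (2 * Real.pi * ξ) ^ 2) ^ ((σ - 1) / 2) *
    (2 * Real.pi * |ξ|) ≤ (1 + (2 * Real.pi * ξ) ^ 2) ^ (σ / 2) := by
  have h0 : 0 < 1 + (2 * Real.pi * ξ) ^ 2 := by positivity
  have : 2 * Real.pi * |ξ| ≤ (1 + (2 * Real.pi * ξ) ^ 2) ^ ((1:ℝ) / 2) := by
    rw [← Real.sqrt_eq_rpow]
    apply Real.le_sqrt_of_sq_le
    rw [mul_pow _ |ξ|, sq_abs]; nlinarith
  calc _ ≤ (1 + (2 * Real.pi * ξ) ^ 2) ^ ((σ - 1) / 2) *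
        (1 + (2 * Real.pi * ξ) ^ 2) ^ ((1:ℝ) / 2) := by gcongr
    _ = _ := by rw [← Real.rpow_add h0]; ring_nf

theorem continuous_bessel (σ : ℝ) :
    Continuous fun ξ : ℝ => (((1 + (2 * Real.pi * ξ) ^ 2) ^ (σ / 2) : ℝ) : ℂ) :=
  Complex.continuous_ofReal.comp <| Continuous.rpow_const (by fun_prop)
    fun ξ => Or.inl (by have := one_le_bessel ξ; positivity)

theorem IsSobolevTransform.norm_toLp_le (hσ : 0 ≤ σ) (h : IsSobolevTransform σ f F) :
    eLpNorm f 2 volume ≤ ENNReal.ofReal ‖F‖ := by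
  obtain ⟨hf, hF⟩ := h
  have h1 : ‖𝓕 (hf.toLp _)‖ ≤ 1 * ‖F‖ := by
    refine norm_Lp_le_of_ae_le ?_
    filter_upwards [hF] with ξ hξ
    rw [hξ, norm_mul, Complex.norm_real, Real.norm_eq_abs, one_mul]
    refine le_mul_of_one_le_left (norm_nonneg _) ?_
    rw [abs_of_nonneg (by positivity)]
    exact Real.one_le_rpow (one_le_bessel ξ) (by positivity)
  rw [Lp.norm_fourier_eq, one_mul, Lp.norm_toLp] at h1
  have h2 : eLpNorm (fun x => (f x : ℂ)) 2 volume = eLpNorm f 2 volume :=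
    eLpNorm_congr_norm_ae (by simp)
  rw [h2] at h1
  rw [← ENNReal.ofReal_toReal (a := eLpNorm f 2 volume) (by rw [← h2]; exact hf.2.ne)]
  exact ENNReal.ofReal_le_ofReal h1

theorem IsSobolevTransform.memLp (h : IsSobolevTransform σ f F) : MemLp f 2 volume := by
  obtain ⟨hf, -⟩ := h
  simpa using hf.re

/-- A function in `H^σ`, `σ ≥ 1`, has a weak derivative in `H^{σ-1}`. -/
theorem IsSobolevTransform.exists_weak_deriv (hσ : 1 ≤ σ) (h : IsSobolevTransform σ f F) :
    ∃ (g : ℝ → ℝ) (F' : Lp ℂ 2 (volume : Measure ℝ)), IsSobolevTransform (σ - 1) g F' ∧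
      ‖F'‖ ≤ ‖F‖ ∧ LocallyIntegrable g volume ∧ ∀ᵐ a, ∀ᵐ b, ∫ x in a..b, g x = f b - f a := by
  obtain ⟨hf, hF⟩ := h
  set k : Lp ℂ 2 (volume : Measure ℝ) := 𝓕 (hf.toLp (fun x : ℝ => (f x : ℂ))) with hk
  have hjm : MemLp (fun ξ : ℝ => 2 * Real.pi * Complex.I * ξ * k ξ) 2 volume := by
    refine MemLp.of_le (Lp.memLp F) ?_ ?_
    · exact (Continuous.aestronglyMeasurable (by fun_prop)).mul (Lp.aestronglyMeasurable k)
    · filter_upwards [hF] with ξ hξ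
      rw [hξ, norm_mul, norm_mul _ (k ξ)]
      gcongr
      simp only [norm_mul, Complex.norm_real, Complex.norm_I, Complex.norm_ofNat, Real.norm_eq_abs]
      rw [abs_of_pos Real.pi_pos, mul_one]
      refine le_trans ?_ ((bessel_mul_le σ ξ).trans (le_abs_self _))
      exact le_mul_of_one_le_left (by positivity)
        (Real.one_le_rpow (one_le_bessel ξ) (by linarith))
  have hFle : ∀ᵐ ξ, ‖(((1 + (2 * Real.pi * ξ) ^ 2) ^ ((σ - 1) / 2) : ℝ) : ℂ) * hjm.toLp _ ξ‖
      ≤ ‖F ξ‖ := by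
    filter_upwards [hF, hjm.coeFn_toLp] with ξ hξ h2
    rw [hξ, h2, norm_mul, norm_mul _ (k ξ), norm_mul _ (k ξ), ← mul_assoc]
    gcongr
    simp only [norm_mul, Complex.norm_real, Complex.norm_I, Complex.norm_ofNat, Real.norm_eq_abs]
    rw [abs_of_pos Real.pi_pos, mul_one, abs_of_nonneg (Real.rpow_nonneg (by positivity) _)]
    exact (bessel_mul_le σ ξ).trans (le_abs_self _)
  have hFm : MemLp (fun ξ : ℝ => (((1 + (2 * Real.pi * ξ) ^ 2) ^ ((σ - 1) / 2) : ℝ) : ℂ) *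
      hjm.toLp _ ξ) 2 volume :=
    MemLp.of_le (Lp.memLp F)
      ((continuous_bessel (σ - 1)).aestronglyMeasurable.mul (Lp.aestronglyMeasurable _)) hFle
  set j := hjm.toLp _ with hj
  set G : Lp ℂ 2 (volume : Measure ℝ) := 𝓕⁻ j with hG
  have hfk : (𝓕⁻ k : Lp ℂ 2 (volume : Measure ℝ)) = hf.toLp _ := by
    rw [hk, FourierTransform.fourierInv_fourier_eq]
  have hGi : ∀ a b, IntervalIntegrable G volume a b := fun a b => intervalIntegrable_iff.mpr <|
    ((locallyIntegrable_of_L2 G).integrableOn_isCompact isCompact_uIcc).mono_set uIoc_subset_uIcc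
  have hab : ∀ᵐ a, ∀ᵐ b, ∫ x in a..b, G x = ((f b - f a : ℝ) : ℂ) := by
    have := L2_fourierInv_sub_ae_eq_integral (k := k) (j := j) hjm.coeFn_toLp
    rw [hfk] at this
    filter_upwards [this, hf.coeFn_toLp] with a ha ha2
    filter_upwards [ha, hf.coeFn_toLp] with b hb hb2
    rw [hb, ha2, hb2]; push_cast; rfl
  -- The primitive of `G` from a generic `a` is real for almost every endpoint, hence for all by
  -- continuity; Lebesgue differentiation then makes `G` real almost everywhere.
  have him : ∀ᵐ x, (G x).im = 0 := by
    obtain ⟨a, ha⟩ := hab.exists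
    have hc : (fun b => (∫ x in a..b, G x).im) = fun _ => (0:ℝ) := by
      refine Continuous.ae_eq_iff_eq volume (Complex.continuous_im.comp
        (intervalIntegral.continuous_primitive hGi a)) continuous_const |>.mp ?_
      filter_upwards [ha] with b hb
      simp only [Function.comp_apply]
      rw [hb, Complex.ofReal_im]
    filter_upwards [_root_.LocallyIntegrable.ae_hasDerivAt_integral (locallyIntegrable_of_L2 G)] with x hx
    have := (hx a)
    have h2 := Complex.imCLM.hasFDerivAt.comp_hasDerivAt x this
    have h3 : HasDerivAt (fun b => (∫ x in a..b, G x).im) ((G x).im) x := h2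
    rw [hc] at h3
    exact h3.unique (hasDerivAt_const x (0:ℝ))
  have hre : (fun x => (((G x).re : ℝ) : ℂ)) =ᵐ[volume] G := by
    filter_upwards [him] with x hx
    exact Complex.ext (by simp) (by simp [hx])
  have hgm : MemLp (fun x => (((G x).re : ℝ) : ℂ)) 2 volume := (Lp.memLp G).ae_eq hre.symm
  refine ⟨fun x => (G x).re, hFm.toLp _, ⟨hgm, ?_⟩, ?_, ?_, ?_⟩
  · have : hgm.toLp _ = G := by
      apply Lp.ext
      exact hgm.coeFn_toLp.trans hre
    rw [this, hG, FourierTransform.fourier_fourierInv_eq]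
    exact hFm.coeFn_toLp
  · rw [← one_mul ‖F‖]
    refine norm_Lp_le_of_ae_le ?_
    filter_upwards [hFm.coeFn_toLp, hFle] with ξ h1 h2
    rw [h1, one_mul]; exact h2
  · have : MemLp (fun x => (G x).re) 2 volume := (Lp.memLp G).re
    exact this.locallyIntegrable (by norm_num)
  · filter_upwards [hab] with a ha
    filter_upwards [ha] with b hb
    have := Complex.reCLM.intervalIntegral_comp_comm (hGi a b)
    simp only [Complex.reCLM_apply] at this
    rw [this, hb, Complex.ofReal_re]

theorem IsSobolevTransform.exists_continuous_rep (hσ : 1 ≤ σ) (h : IsSobolevTransform σ f F) :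
    ∃ (f' g : ℝ → ℝ) (F' : Lp ℂ 2 (volume : Measure ℝ)), f =ᵐ[volume] f' ∧ IsPrimitive f' g ∧
      IsSobolevTransform (σ - 1) g F' ∧ ‖F'‖ ≤ ‖F‖ := by
  obtain ⟨g, F', hg, hle, hloc, hab⟩ := h.exists_weak_deriv hσ
  have hgi : ∀ a b, IntervalIntegrable g volume a b := fun a b => intervalIntegrable_iff.mpr <|
    (hloc.integrableOn_isCompact isCompact_uIcc).mono_set uIoc_subset_uIcc
  obtain ⟨a, ha⟩ := hab.exists
  refine ⟨fun b => f a + ∫ x in a..b, g x, g, F', ?_, ⟨hloc, fun c d => ?_⟩, hg, hle⟩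
  · filter_upwards [ha] with b hb
    rw [hb]; ring
  · rw [← intervalIntegral.integral_add_adjacent_intervals (hgi a c) (hgi c d)]; ring

theorem IsSobolevTransform.isPrimitive_deriv (hσ : 1 ≤ σ) (h : IsSobolevTransform σ f F)
    (hf : Continuous f) : IsPrimitive f (deriv f) ∧
      ∃ F' : Lp ℂ 2 (volume : Measure ℝ), IsSobolevTransform (σ - 1) (deriv f) F' ∧ ‖F'‖ ≤ ‖F‖ := by
  obtain ⟨f', g, F', hae, hp, hg, hle⟩ := h.exists_continuous_rep hσ
  obtain rfl : f = f' := (Continuous.ae_eq_iff_eq volume hf hp.continuous).mp hae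
  exact ⟨hp.congr_right hp.ae_deriv_eq.symm, F', hg.congr hp.ae_deriv_eq.symm, hle⟩

theorem IsSobolevTransform.hasDerivAt (hσ : 2 ≤ σ) (h : IsSobolevTransform σ f F)
    (hf : Continuous f) : Continuous (deriv f) ∧ ∀ x, HasDerivAt f (deriv f x) x := by
  obtain ⟨hp, F', hF', -⟩ := h.isPrimitive_deriv (by linarith) hf
  obtain ⟨g, g', -, hae, hg, -⟩ := hF'.exists_continuous_rep (by linarith)
  have key := (hp.congr_right hae).hasDerivAt hg.continuous
  have : deriv f = g := funext fun x => (key x).deriv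
  rw [this]
  exact ⟨hg.continuous, key⟩

theorem exists_enorm_le_eLpNorm_two {f : ℝ → ℝ} (hf : AEStronglyMeasurable f volume) (a : ℝ) :
    ∃ y ∈ Icc a (a + 1), ‖f y‖ₑ ≤ eLpNorm f 2 volume := by
  obtain ⟨y, hy, hle⟩ := exists_le_setLAverage (μ := volume) (s := Icc a (a + 1))
    (f := fun x => ‖f x‖ₑ ^ (2:ℝ)) (by simp) (by simp)
    (hf.enorm.pow_const _).restrict
  refine ⟨y, hy, ?_⟩
  have h1 : ‖f y‖ₑ ^ (2:ℝ) ≤ eLpNorm f 2 volume ^ (2:ℝ) := by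
    refine hle.trans ?_
    have h2 : eLpNorm f 2 volume ^ (2:ℝ) = ∫⁻ x, ‖f x‖ₑ ^ (2:ℝ) := by
      have := eLpNorm_nnreal_pow_eq_lintegral (μ := volume) (f := f) (p := 2) (by norm_num)
      simpa using this
    rw [h2, setLAverage_eq]
    simp only [Real.volume_Icc, add_sub_cancel_left, ENNReal.ofReal_one, div_one]
    exact setLIntegral_le_lintegral _ _
  exact (ENNReal.rpow_le_rpow_iff (by norm_num)).mp h1

/-- The embedding of `H¹` in `L^∞`: somewhere in `[x, x+1]` the value is at most the `L²` norm, by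
averaging, and the variation from there to `x` is at most the `L¹` norm of `g` on a unit interval,
thus at most its `L²` norm. -/
theorem IsPrimitive.enorm_le {f g : ℝ → ℝ} (h : IsPrimitive f g) (x : ℝ) :
    ‖f x‖ₑ ≤ eLpNorm f 2 volume + eLpNorm g 2 volume := by
  obtain ⟨y, hy, hle⟩ := exists_enorm_le_eLpNorm_two h.continuous.aestronglyMeasurable x
  have h1 : f x = f y - ∫ z in x..y, g z := by rw [h.integral_eq]; ring
  rw [h1]
  refine (enorm_sub_le).trans (add_le_add hle ?_)
  rw [intervalIntegral.integral_of_le hy.1]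
  refine (enorm_integral_le_lintegral_enorm _).trans ?_
  have : IsProbabilityMeasure (volume.restrict (Icc x (x + 1))) := ⟨by simp⟩
  calc ∫⁻ z in Ioc x y, ‖g z‖ₑ ≤ ∫⁻ z in Icc x (x + 1), ‖g z‖ₑ :=
        lintegral_mono_set (Ioc_subset_Icc_self.trans (Icc_subset_Icc_right hy.2))
    _ = eLpNorm g 1 (volume.restrict (Icc x (x + 1))) := eLpNorm_one_eq_lintegral_enorm.symm
    _ ≤ eLpNorm g 2 (volume.restrict (Icc x (x + 1))) :=
        eLpNorm_le_eLpNorm_of_exponent_le (by norm_num)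
          h.locallyIntegrable.aestronglyMeasurable.restrict
    _ ≤ eLpNorm g 2 volume := eLpNorm_mono_measure _ Measure.restrict_le_self

theorem IsSobolevTransform.abs_le (hσ : 1 ≤ σ) (h : IsSobolevTransform σ f F)
    (hf : Continuous f) (x : ℝ) : |f x| ≤ 2 * ‖F‖ := by
  obtain ⟨hp, F', hF', hle⟩ := h.isPrimitive_deriv hσ hf
  have h1 : ‖f x‖ₑ ≤ ENNReal.ofReal (2 * ‖F‖) := by
    refine (hp.enorm_le x).trans ?_
    rw [two_mul, ENNReal.ofReal_add (norm_nonneg _) (norm_nonneg _)]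
    exact add_le_add (h.norm_toLp_le (by linarith)) ((hF'.norm_toLp_le (by linarith)).trans
      (ENNReal.ofReal_le_ofReal hle))
  rw [← ofReal_norm, ENNReal.ofReal_le_ofReal_iff (by positivity)] at h1
  exact h1

theorem IsSobolevTransform.eLpNorm_potential_le (hσ : 2 ≤ σ) (h : IsSobolevTransform σ f F)
    (hf : Continuous f) : MemLp (potential f) 2 volume ∧
      eLpNorm (potential f) 2 volume ≤ ENNReal.ofReal (2 * ‖F‖) := by
  obtain ⟨hp, F', hF', hle⟩ := h.isPrimitive_deriv (by linarith) hf
  obtain ⟨hp2, F'', hF'', hle2⟩ := hF'.isPrimitive_deriv (by linarith) (h.hasDerivAt hσ hf).1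
  have e : potential f = f - deriv (deriv f) := rfl
  rw [e]
  refine ⟨h.memLp.sub hF''.memLp, ?_⟩
  refine (eLpNorm_sub_le h.memLp.1 hF''.memLp.1 (by norm_num)).trans ?_
  rw [two_mul, ENNReal.ofReal_add (norm_nonneg _) (norm_nonneg _)]
  exact add_le_add (h.norm_toLp_le (by linarith)) ((hF''.norm_toLp_le (by linarith)).trans
      (ENNReal.ofReal_le_ofReal (hle2.trans hle)))

/-- The regularity of `f ∈ H³(ℝ)` that the energy estimate uses, with a common bound. -/
structure RegularProfile (B : ℝ) (f : ℝ → ℝ) : Prop where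
  hasDerivAt : ∀ x, HasDerivAt f (deriv f x) x
  hasDerivAt_deriv : ∀ x, HasDerivAt (deriv f) (deriv (deriv f) x) x
  continuous_deriv_deriv : Continuous (deriv (deriv f))
  abs_le : ∀ x, |f x| ≤ B
  abs_deriv_le : ∀ x, |deriv f x| ≤ B
  abs_potential_le : ∀ x, |potential f x| ≤ B
  memLp_potential : MemLp (potential f) 2 volume
  isPrimitive_potential : IsPrimitive (potential f) (deriv (potential f))
  memLp_deriv_potential : MemLp (deriv (potential f)) 2 volume

theorem RegularProfile.mono {B B' : ℝ} (h : RegularProfile B f) (hB : B ≤ B') :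
    RegularProfile B' f :=
  { h with
    abs_le := fun x => (h.abs_le x).trans hB
    abs_deriv_le := fun x => (h.abs_deriv_le x).trans hB
    abs_potential_le := fun x => (h.abs_potential_le x).trans hB }

theorem IsSobolevTransform.regularProfile (hσ : 3 ≤ σ) (h : IsSobolevTransform σ f F)
    (hf : Continuous f) : RegularProfile (4 * ‖F‖) f := by
  obtain ⟨hp, F', hF', hle⟩ := h.isPrimitive_deriv (by linarith) hf
  obtain ⟨hc1, hd1⟩ := h.hasDerivAt (by linarith) hf
  obtain ⟨hp2, F'', hF'', hle2⟩ := hF'.isPrimitive_deriv (by linarith) hc1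
  obtain ⟨hc2, hd2⟩ := hF'.hasDerivAt (by linarith) hc1
  obtain ⟨hp3, F3, hF3, hle3⟩ := hF''.isPrimitive_deriv (by linarith) hc2
  have hpot : IsPrimitive (potential f) (fun x => deriv f x - deriv (deriv (deriv f)) x) :=
    hp.sub hp3
  have b0 := h.abs_le (by linarith) hf
  have b1 := hF'.abs_le (by linarith) hc1
  have b2 := hF''.abs_le (by linarith) hc2
  have hn := norm_nonneg F
  refine ⟨hd1, hd2, hc2, fun x => (b0 x).trans (by linarith), fun x => (b1 x).trans (by linarith),
    fun x => ?_, (h.eLpNorm_potential_le (by linarith) hf).1,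
    hpot.congr_right hpot.ae_deriv_eq.symm, ?_⟩
  · have := abs_sub (f x) (deriv (deriv f) x)
    have h0 := b0 x
    have h2 := b2 x
    unfold potential
    linarith
  · exact (hF'.memLp.sub hF3.memLp).ae_eq hpot.ae_deriv_eq.symm

/-- This combination is the first-order Taylor remainder in time, to which the bound on potentials
is applied. -/
theorem IsSobolevTransform.sub_sub_mul {g h : ℝ → ℝ} {G H : Lp ℂ 2 (volume : Measure ℝ)}
    (hf : IsSobolevTransform σ f F) (hg : IsSobolevTransform σ g G)
    (hh : IsSobolevTransform σ h H) (c : ℝ) :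
    IsSobolevTransform σ (fun x => f x - g x - c * h x) (F - G - c • H) := by
  obtain ⟨mf, hF⟩ := hf
  obtain ⟨mg, hG⟩ := hg
  obtain ⟨mh, hH⟩ := hh
  have e : (fun x => ((f x - g x - c * h x : ℝ) : ℂ)) =
      (fun x => (f x : ℂ)) - (fun x => (g x : ℂ)) - (c : ℂ) • fun x => (h x : ℂ) := by
    funext x; simp
  have m : MemLp (fun x => ((f x - g x - c * h x : ℝ) : ℂ)) 2 volume := by
    rw [e]; exact (mf.sub mg).sub (mh.const_smul _)
  have eL : m.toLp _ = mf.toLp _ - mg.toLp _ - (c : ℂ) • mh.toLp _ := by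
    rw [← MemLp.toLp_sub, ← MemLp.toLp_const_smul, ← MemLp.toLp_sub]
    exact MemLp.toLp_congr _ _ (by rw [e])
  have eF : (𝓕 (m.toLp _) : Lp ℂ 2 (volume : Measure ℝ)) =
      𝓕 (mf.toLp _) - 𝓕 (mg.toLp _) - (c : ℂ) • 𝓕 (mh.toLp _) := by
    rw [eL]
    change Lp.fourierTransformₗᵢ ℝ ℂ _ = _
    rw [map_sub, map_sub, map_smul]
    rfl
  refine ⟨m, ?_⟩
  rw [eF]
  filter_upwards [hF, hG, hH, Lp.coeFn_sub (F - G) (c • H), Lp.coeFn_sub F G, Lp.coeFn_smul c H,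
    Lp.coeFn_sub (𝓕 (mf.toLp _) - 𝓕 (mg.toLp _)) ((c : ℂ) • 𝓕 (mh.toLp _)),
    Lp.coeFn_sub (𝓕 (mf.toLp _)) (𝓕 (mg.toLp _)), Lp.coeFn_smul (c : ℂ) (𝓕 (mh.toLp _))]
    with ξ h1 h2 h3 h4 h5 h6 h7 h8 h9
  rw [h4, h7, Pi.sub_apply, Pi.sub_apply, h5, h8, Pi.sub_apply, Pi.sub_apply, h6, h9,
    Pi.smul_apply, Pi.smul_apply, h1, h2, h3, Complex.real_smul, smul_eq_mul]
  ring

/-- The map `f ↦ f - f_xx` is linear and bounded from `H²` to `L²`, so it carries an `o(r - t)`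
remainder to an `o(r - t)` remainder. -/
theorem HasContinuousDerivInHs.hasDerivWithinAt_potential {I : Set ℝ} {u u' : ℝ → ℝ → ℝ}
    (hσ : 2 ≤ σ) (h : HasContinuousDerivInHs σ I u u') (hu : ∀ t ∈ I, Continuous (u t))
    (hu' : ∀ t ∈ I, Continuous (u' t)) :
    ∃ M M' : ℝ → Lp ℝ 2 (volume : Measure ℝ), (∀ t ∈ I, M t =ᵐ[volume] potential (u t)) ∧
      (∀ t ∈ I, M' t =ᵐ[volume] potential (u' t)) ∧
      ∀ t ∈ I, HasDerivWithinAt M (M' t) I t := by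
  classical
  obtain ⟨F, F', hF, hF', hd, -⟩ := h
  have hm : ∀ t ∈ I, MemLp (potential (u t)) 2 volume := fun t ht =>
    ((hF t ht).eLpNorm_potential_le hσ (hu t ht)).1
  have hm' : ∀ t ∈ I, MemLp (potential (u' t)) 2 volume := fun t ht =>
    ((hF' t ht).eLpNorm_potential_le hσ (hu' t ht)).1
  -- The value `0` outside `I` is harmless, since derivatives are taken within `I`.
  let M : ℝ → Lp ℝ 2 (volume : Measure ℝ) := fun t => if ht : t ∈ I then (hm t ht).toLp _ else 0
  let M' : ℝ → Lp ℝ 2 (volume : Measure ℝ) := fun t => if ht : t ∈ I then (hm' t ht).toLp _ else 0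
  have hM : ∀ t ∈ I, M t =ᵐ[volume] potential (u t) := fun t ht => by
    simp only [M, ht, dif_pos]; exact MemLp.coeFn_toLp _
  have hM' : ∀ t ∈ I, M' t =ᵐ[volume] potential (u' t) := fun t ht => by
    simp only [M', ht, dif_pos]; exact MemLp.coeFn_toLp _
  refine ⟨M, M', hM, hM', fun t ht => ?_⟩
  have hdt := hd t ht
  rw [hasDerivWithinAt_iff_isLittleO] at hdt ⊢
  refine IsBigO.trans_isLittleO (IsBigO.of_bound 2 ?_) hdt
  filter_upwards [self_mem_nhdsWithin] with r hr
  set c := r - t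
  have hT := (hF r hr).sub_sub_mul (hF t ht) (hF' t ht) c
  have hcont : Continuous fun x => u r x - u t x - c * u' t x :=
    ((hu r hr).sub (hu t ht)).sub (continuous_const.mul (hu' t ht))
  have hle := (hT.eLpNorm_potential_le hσ hcont).2
  have hae : (M r - M t - c • M' t : Lp ℝ 2 (volume : Measure ℝ)) =ᵐ[volume]
      potential fun x => u r x - u t x - c * u' t x := by
    obtain ⟨hr1, Fr, hFr, -⟩ := (hF r hr).isPrimitive_deriv (by linarith) (hu r hr)
    obtain ⟨ht1, Ft, hFt, -⟩ := (hF t ht).isPrimitive_deriv (by linarith) (hu t ht)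
    obtain ⟨hs1, Fs, hFs, -⟩ := (hF' t ht).isPrimitive_deriv (by linarith) (hu' t ht)
    obtain ⟨cr, dr⟩ := (hF r hr).hasDerivAt hσ (hu r hr)
    obtain ⟨ct, dt⟩ := (hF t ht).hasDerivAt hσ (hu t ht)
    obtain ⟨cs, ds⟩ := (hF' t ht).hasDerivAt hσ (hu' t ht)
    have d1 : deriv (fun x => u r x - u t x - c * u' t x) =
        fun x => deriv (u r) x - deriv (u t) x - c * deriv (u' t) x :=
      funext fun x => (((dr x).sub (dt x)).sub ((ds x).const_mul c)).deriv
    filter_upwards [hM r hr, hM t ht, hM' t ht, Lp.coeFn_sub (M r - M t) (c • M' t),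
      Lp.coeFn_sub (M r) (M t), Lp.coeFn_smul c (M' t),
      (hFr.isPrimitive_deriv (by linarith) cr).1.ae_hasDerivAt,
      (hFt.isPrimitive_deriv (by linarith) ct).1.ae_hasDerivAt,
      (hFs.isPrimitive_deriv (by linarith) cs).1.ae_hasDerivAt] with x h1 h2 h3 h4 h5 h6 h7 h8 h9
    rw [h4, Pi.sub_apply, h5, Pi.sub_apply, h6, Pi.smul_apply, h1, h2, h3, smul_eq_mul]
    unfold potential
    have d2 : deriv (fun x => deriv (u r) x - deriv (u t) x - c * deriv (u' t) x) x = _ :=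
      ((h7.sub h8).sub (h9.const_mul c)).deriv
    rw [d1, d2]
    ring
  rw [Lp.norm_def, eLpNorm_congr_ae hae]
  refine ENNReal.toReal_le_of_le_ofReal (by positivity) hle

end Sobolev

/-! ### Calculus of `|y| ^ q` for `q ≥ 2`. -/

theorem _root_.AbsolutelyContinuousOnInterval.comp_contDiff {f g : ℝ → ℝ} {a b : ℝ}
    (hg : ContDiff ℝ 1 g) (hf : AbsolutelyContinuousOnInterval f a b) :
    AbsolutelyContinuousOnInterval (fun x => g (f x)) a b := by
  obtain ⟨C, hC⟩ := hf.exists_bound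
  obtain ⟨K, hK⟩ := (hg.contDiffOn (s := Icc (-C) C)).exists_lipschitzOnWith (by decide)
    (convex_Icc _ _) isCompact_Icc
  have hmem : ∀ x ∈ uIcc a b, f x ∈ Icc (-C) C := fun x hx => abs_le.mp (hC x hx)
  unfold AbsolutelyContinuousOnInterval at hf
  apply squeeze_zero' ?_ ?_ (by simpa using hf.const_mul (K : ℝ))
  · exact Filter.Eventually.of_forall <| fun _ ↦ Finset.sum_nonneg (fun i hi ↦ dist_nonneg)
  rw [eventually_inf_principal]
  filter_upwards with (n, I) hnI
  simp only [Finset.mul_sum]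
  gcongr with i hi
  exact hK.dist_le_mul _ (hmem _ (hnI.left i hi |>.left)) _ (hmem _ (hnI.left i hi |>.right))

/-- The derivative of `|y| ^ q`. -/
def powDeriv (q y : ℝ) : ℝ := q * |y| ^ (q - 2) * y

theorem hasDerivAt_abs_rpow_powDeriv {q : ℝ} (hq : 2 ≤ q) (y : ℝ) :
    HasDerivAt (fun y : ℝ => |y| ^ q) (powDeriv q y) y :=
  hasDerivAt_abs_rpow y (by linarith)

theorem powDeriv_neg (q y : ℝ) : powDeriv q (-y) = -powDeriv q y := by
  unfold powDeriv; rw [abs_neg]; ring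

theorem powDeriv_of_nonneg {q y : ℝ} (hq : 2 ≤ q) (hy : 0 ≤ y) :
    powDeriv q y = q * y ^ (q - 1) := by
  unfold powDeriv
  rcases hy.eq_or_lt with rfl | hy'
  · rw [Real.zero_rpow (by linarith)]; simp
  · rw [abs_of_pos hy', mul_assoc, ← Real.rpow_add_one hy'.ne']; ring_nf

theorem abs_powDeriv {q : ℝ} (hq : 2 ≤ q) (y : ℝ) : |powDeriv q y| = q * |y| ^ (q - 1) := by
  have h : |powDeriv q y| = powDeriv q |y| := by
    unfold powDeriv
    rw [abs_mul, abs_mul, abs_abs, abs_of_nonneg (by linarith : 0 ≤ q),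
      abs_of_nonneg (by positivity : 0 ≤ |y| ^ (q - 2))]
  rw [h, powDeriv_of_nonneg hq (abs_nonneg y)]

theorem powDeriv_mul_self {q : ℝ} (hq : 2 ≤ q) (y : ℝ) : powDeriv q y * y = q * |y| ^ q := by
  unfold powDeriv
  rcases eq_or_ne y 0 with rfl | hy
  · simp [Real.zero_rpow (by linarith : q ≠ 0)]
  · have : |y| ^ q = |y| ^ (q - 2) * y ^ 2 := by
      rw [← sq_abs y, ← Real.rpow_add_natCast (abs_pos.mpr hy).ne']; norm_num
    rw [this]; ring

theorem continuous_powDeriv {q : ℝ} (hq : 2 ≤ q) : Continuous (powDeriv q) := by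
  unfold powDeriv
  exact (continuous_const.mul (continuous_abs.rpow_const fun _ => Or.inr (by linarith))).mul
    continuous_id

theorem contDiff_abs_rpow {q : ℝ} (hq : 2 ≤ q) : ContDiff ℝ 1 (fun y : ℝ => |y| ^ q) := by
  rw [contDiff_one_iff_deriv]
  refine ⟨fun y => (hasDerivAt_abs_rpow_powDeriv hq y).differentiableAt, ?_⟩
  rw [show deriv (fun y : ℝ => |y| ^ q) = powDeriv q from
    funext fun y => (hasDerivAt_abs_rpow_powDeriv hq y).deriv]
  exact continuous_powDeriv hq

/-- A crude form of Young's inequality: the larger of `|y|`, `|z|` replaces the other. What matters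
is that the constant is linear in `q`. -/
theorem abs_powDeriv_mul_le {q : ℝ} (hq : 2 ≤ q) (y z : ℝ) :
    |powDeriv q y| * |z| ≤ q * (|y| ^ q + |z| ^ q) := by
  rw [abs_powDeriv hq, mul_assoc]
  refine mul_le_mul_of_nonneg_left ?_ (by linarith)
  have key : ∀ w : ℝ, 0 ≤ w → w ^ (q - 1) * w = w ^ q := by
    intro w hw
    rcases hw.eq_or_lt with rfl | hw
    · simp [Real.zero_rpow (by linarith : q ≠ 0)]
    · rw [← Real.rpow_add_one hw.ne']; norm_num
  rcases le_total |y| |z| with h | h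
  · calc |y| ^ (q - 1) * |z| ≤ |z| ^ (q - 1) * |z| := by gcongr; linarith
      _ = |z| ^ q := key _ (abs_nonneg z)
      _ ≤ _ := le_add_of_nonneg_left (by positivity)
  · calc |y| ^ (q - 1) * |z| ≤ |y| ^ (q - 1) * |y| := by gcongr
      _ = |y| ^ q := key _ (abs_nonneg y)
      _ ≤ _ := le_add_of_nonneg_right (by positivity)

theorem rpow_sub_rpow_le {r B a b : ℝ} (hr : 1 ≤ r) (ha : 0 ≤ a) (hab : a ≤ b) (hb : b ≤ B) :
    b ^ r - a ^ r ≤ r * B ^ (r - 1) * (b - a) := by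
  rcases hab.eq_or_lt with rfl | hab
  · simp
  obtain ⟨c, hc, h⟩ := exists_hasDerivAt_eq_slope (fun x : ℝ => x ^ r) (fun x => r * x ^ (r - 1)) hab
    (Real.continuous_rpow_const (by linarith)).continuousOn
    (fun x _ => Real.hasDerivAt_rpow_const (Or.inr hr))
  rw [eq_div_iff (by linarith)] at h
  rw [← h]
  have : c ^ (r - 1) ≤ B ^ (r - 1) :=
    Real.rpow_le_rpow (ha.trans hc.1.le) (hc.2.le.trans hb) (by linarith)
  gcongr

/-- On each half-line this is the mean value theorem for `y ^ (q - 1)`; `powDeriv` is odd, and an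
interval containing `0` is split there. -/
theorem powDeriv_sub_le {q B a b : ℝ} (hq : 2 ≤ q) (hab : a ≤ b) (ha : -B ≤ a) (hb : b ≤ B) :
    |powDeriv q b - powDeriv q a| ≤ q * ((q - 1) * B ^ (q - 2)) * (b - a) := by
  have key : ∀ {a b : ℝ}, 0 ≤ a → a ≤ b → b ≤ B →
      |powDeriv q b - powDeriv q a| ≤ q * ((q - 1) * B ^ (q - 2)) * (b - a) := by
    intro a b ha hab hb
    have h1 := rpow_sub_rpow_le (r := q - 1) (by linarith) ha hab hb
    have h2 : a ^ (q - 1) ≤ b ^ (q - 1) := Real.rpow_le_rpow ha hab (by linarith)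
    rw [powDeriv_of_nonneg hq ha, powDeriv_of_nonneg hq (ha.trans hab), ← mul_sub, abs_mul,
      abs_of_nonneg (by linarith : 0 ≤ q), abs_of_nonneg (by linarith), mul_assoc]
    rw [show q - 1 - 1 = q - 2 by ring] at h1
    gcongr
  rcases le_total 0 a with h0 | h0
  · exact key h0 hab hb
  rcases le_total b 0 with h1 | h1
  · have := key (a := -b) (b := -a) (by linarith) (by linarith) (by linarith)
    rw [powDeriv_neg, powDeriv_neg] at this
    rw [show powDeriv q b - powDeriv q a = -powDeriv q a - -powDeriv q b by ring]
    linarith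
  · have h2 := key (a := 0) (b := b) le_rfl h1 hb
    have h3 := key (a := 0) (b := -a) le_rfl (by linarith) (by linarith)
    have h4 : powDeriv q 0 = 0 := by simp [powDeriv]
    rw [powDeriv_neg, h4] at h3
    rw [h4] at h2
    have := abs_sub (powDeriv q b - 0) (-(-powDeriv q a - 0))
    rw [abs_neg] at this
    rw [show powDeriv q b - powDeriv q a = powDeriv q b - 0 - -(-powDeriv q a - 0) by ring]
    linarith

/-- A remainder quadratic in `b - a` integrates to a squared `L²` norm, which is what
differentiating the energy in time requires. -/
theorem abs_rpow_taylor {q B a b : ℝ} (hq : 2 ≤ q) (ha : |a| ≤ B) (hb : |b| ≤ B) :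
    |(|b| ^ q - |a| ^ q - powDeriv q a * (b - a))| ≤ q * ((q - 1) * B ^ (q - 2)) * (b - a) ^ 2 := by
  set L := q * ((q - 1) * B ^ (q - 2))
  have hB : 0 ≤ B := (abs_nonneg a).trans ha
  have hL : 0 ≤ L := mul_nonneg (by linarith) (mul_nonneg (by linarith) (by positivity))
  obtain ⟨ha1, ha2⟩ := abs_le.mp ha
  obtain ⟨hb1, hb2⟩ := abs_le.mp hb
  rcases lt_trichotomy a b with h | rfl | h
  · obtain ⟨c, hc, hs⟩ := exists_hasDerivAt_eq_slope (fun y : ℝ => |y| ^ q) (powDeriv q) h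
      (contDiff_abs_rpow hq).continuous.continuousOn
      (fun x _ => hasDerivAt_abs_rpow_powDeriv hq x)
    rw [eq_div_iff (by linarith)] at hs
    rw [← hs, ← sub_mul, abs_mul, abs_of_pos (by linarith : 0 < b - a), sq, ← mul_assoc]
    have h1 := powDeriv_sub_le hq hc.1.le ha1 (hc.2.le.trans hb2)
    have h2 : L * (c - a) ≤ L * (b - a) := by gcongr; exact hc.2.le
    have : 0 ≤ b - a := by linarith
    gcongr
    exact h1.trans h2
  · simp
  · obtain ⟨c, hc, hs⟩ := exists_hasDerivAt_eq_slope (fun y : ℝ => |y| ^ q) (powDeriv q) h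
      (contDiff_abs_rpow hq).continuous.continuousOn
      (fun x _ => hasDerivAt_abs_rpow_powDeriv hq x)
    rw [eq_div_iff (by linarith)] at hs
    have e : |b| ^ q - |a| ^ q - powDeriv q a * (b - a) = (powDeriv q a - powDeriv q c) * (a - b) := by
      linear_combination hs
    rw [e, abs_mul, abs_of_pos (by linarith : 0 < a - b), show (b - a) ^ 2 = (a - b) * (a - b) by ring,
      ← mul_assoc]
    have h1 := powDeriv_sub_le hq hc.2.le (hb1.trans hc.1.le) ha2
    have h2 : L * (a - c) ≤ L * (a - b) := by gcongr; exact hc.1.le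
    have : 0 ≤ a - b := by linarith
    gcongr
    exact h1.trans h2

/-! ### The weighted energy: time derivative and production. -/

/-- Weights for the energy estimate: integrable, vanishing at infinity, with logarithmic derivative
bounded by `κ`. -/
structure EnergyWeight (κ : ℝ) (ρ : ℝ → ℝ) : Prop where
  nonneg : ∀ x, 0 ≤ ρ x
  continuous : Continuous ρ
  bounded : ∃ R, ∀ x, ρ x ≤ R
  integrable : Integrable ρ
  absolutelyContinuousOnInterval : ∀ a b, AbsolutelyContinuousOnInterval ρ a b
  ae_deriv_le : ∀ᵐ x, DifferentiableAt ℝ ρ x ∧ |deriv ρ x| ≤ κ * ρ x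
  tendsto_atTop : Tendsto ρ atTop (𝓝 0)
  tendsto_atBot : Tendsto ρ atBot (𝓝 0)

theorem EnergyWeight.memLp_two {κ : ℝ} {ρ : ℝ → ℝ} (h : EnergyWeight κ ρ) : MemLp ρ 2 volume := by
  obtain ⟨R, hR⟩ := h.bounded
  rw [memLp_two_iff_integrable_sq h.continuous.aestronglyMeasurable]
  refine (h.integrable.const_mul R).mono' (h.continuous.pow 2).aestronglyMeasurable ?_
  filter_upwards with x
  rw [Real.norm_eq_abs, abs_of_nonneg (by positivity), sq]
  exact mul_le_mul_of_nonneg_right (hR x) (h.nonneg x)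

theorem memLp_bdd_mul {f g : ℝ → ℝ} {p : ENNReal} {C : ℝ} (hg : MemLp g p volume)
    (hf : AEStronglyMeasurable f volume) (hC : ∀ᵐ x, |f x| ≤ C) :
    MemLp (fun x => f x * g x) p volume :=
  hg.of_le_mul (c := C) (hf.mul hg.1) <| by
    filter_upwards [hC] with x hx
    rw [norm_mul]
    exact mul_le_mul_of_nonneg_right hx (norm_nonneg _)

/-- Linearise at `t`. The linear part is the inner product of `M s` with a fixed element of `L²`;
the rest is at most a constant times `‖M s - M t‖²`, which is `o(s - t)`. -/
theorem hasDerivWithinAt_integral_abs_rpow {q B κ : ℝ} (hq : 2 ≤ q) {ρ : ℝ → ℝ}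
    (hρ : EnergyWeight κ ρ) {I : Set ℝ} {M : ℝ → Lp ℝ 2 (volume : Measure ℝ)}
    {M' : Lp ℝ 2 (volume : Measure ℝ)} (hB : ∀ s ∈ I, ∀ᵐ x, |M s x| ≤ B)
    {t : ℝ} (ht : t ∈ I) (hd : HasDerivWithinAt M M' I t) :
    HasDerivWithinAt (fun s => ∫ x, |M s x| ^ q * ρ x)
      (∫ x, powDeriv q (M t x) * M' x * ρ x) I t := by
  obtain ⟨R, hR⟩ := hρ.bounded
  set L := q * ((q - 1) * B ^ (q - 2)) with hL
  have hΦi : ∀ s ∈ I, Integrable (fun x => |M s x| ^ q * ρ x) := fun s hs => by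
    rw [← memLp_one_iff_integrable]
    refine memLp_bdd_mul (C := B ^ q) (memLp_one_iff_integrable.mpr hρ.integrable)
      ((contDiff_abs_rpow hq).continuous.comp_aestronglyMeasurable (Lp.aestronglyMeasurable _)) ?_
    filter_upwards [hB s hs] with x hx
    rw [abs_of_nonneg (by positivity)]
    exact Real.rpow_le_rpow (abs_nonneg _) hx (by linarith)
  have hΨm : MemLp (fun x => powDeriv q (M t x) * ρ x) 2 volume := by
    refine memLp_bdd_mul (C := q * B ^ (q - 1)) hρ.memLp_two
      ((continuous_powDeriv hq).comp_aestronglyMeasurable (Lp.aestronglyMeasurable _)) ?_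
    filter_upwards [hB t ht] with x hx
    rw [abs_powDeriv hq]
    gcongr
    linarith
  set Ψ := hΨm.toLp _ with hΨ
  have hinner : ∀ X : Lp ℝ 2 (volume : Measure ℝ),
      inner ℝ Ψ X = ∫ x, powDeriv q (M t x) * X x * ρ x := fun X => by
    rw [L2.inner_def]
    refine integral_congr_ae ?_
    filter_upwards [hΨm.coeFn_toLp] with x hx
    rw [hx]
    simp; ring
  have hΨi : ∀ X : Lp ℝ 2 (volume : Measure ℝ),
      Integrable (fun x => powDeriv q (M t x) * X x * ρ x) := fun X => by
    refine ((hΨm.integrable_mul (Lp.memLp X))).congr ?_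
    filter_upwards with x
    simp only [Pi.mul_apply]; ring
  have hlin : HasDerivWithinAt (fun s => inner ℝ Ψ (M s)) (inner ℝ Ψ M') I t := by
    simpa using (hasDerivWithinAt_const t I Ψ).inner ℝ hd
  have hrem : HasDerivWithinAt (fun s => (∫ x, |M s x| ^ q * ρ x) - inner ℝ Ψ (M s)) 0 I t := by
    rw [hasDerivWithinAt_iff_isLittleO]
    have hO : (fun s => M s - M t) =O[𝓝[I] t] fun s => s - t := hd.differentiableWithinAt.isBigO_sub
    have hO2 : (fun s => ‖M s - M t‖ * ‖M s - M t‖) =o[𝓝[I] t] fun s => s - t := by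
      have h1 := hO.norm_left.mul hO.norm_left
      refine h1.trans_isLittleO ?_
      have h2 : Tendsto (fun s => s - t) (𝓝[I] t) (𝓝 0) :=
        (by simpa using (tendsto_id (x := 𝓝 t)).sub_const t :
          Tendsto (fun s => s - t) (𝓝 t) (𝓝 0)).mono_left
          nhdsWithin_le_nhds
      simpa using ((isLittleO_one_iff ℝ).mpr h2).mul_isBigO (isBigO_refl (fun s => s - t) (𝓝[I] t))
    refine IsBigO.trans_isLittleO (IsBigO.of_bound (L * R) ?_) hO2
    filter_upwards [self_mem_nhdsWithin] with s hs
    have e : (∫ x, |M s x| ^ q * ρ x) - inner ℝ Ψ (M s) -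
        ((∫ x, |M t x| ^ q * ρ x) - inner ℝ Ψ (M t)) - (s - t) • (0:ℝ) =
        ∫ x, (|M s x| ^ q - |M t x| ^ q - powDeriv q (M t x) * (M s x - M t x)) * ρ x := by
      have i1 : Integrable fun x => |M s x| ^ q * ρ x - powDeriv q (M t x) * M s x * ρ x :=
        (hΦi s hs).sub (hΨi _)
      have i2 : Integrable fun x => |M t x| ^ q * ρ x - powDeriv q (M t x) * M t x * ρ x :=
        (hΦi t ht).sub (hΨi _)
      rw [hinner, hinner, ← integral_sub (hΦi s hs) (hΨi _), ← integral_sub (hΦi t ht) (hΨi _),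
        ← integral_sub i1 i2, smul_zero, sub_zero]
      refine integral_congr_ae ?_
      filter_upwards with x
      ring
    have e2 : ‖M s - M t‖ * ‖M s - M t‖ = ∫ x, (M s x - M t x) ^ 2 := by
      rw [← real_inner_self_eq_norm_mul_norm, L2.inner_def]
      refine integral_congr_ae ?_
      filter_upwards [Lp.coeFn_sub (M s) (M t)] with x hx
      rw [hx]
      simp [sq]
    rw [e, norm_mul, norm_norm, e2, ← integral_const_mul]
    refine norm_integral_le_of_norm_le ?_ ?_
    · refine Integrable.const_mul ?_ _
      refine (MemLp.integrable_sq (Lp.memLp (M s - M t))).congr ?_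
      filter_upwards [Lp.coeFn_sub (M s) (M t)] with x hx
      rw [hx]; rfl
    · filter_upwards [hB s hs, hB t ht] with x h1 h2
      rw [norm_mul, Real.norm_eq_abs, Real.norm_eq_abs, abs_of_nonneg (hρ.nonneg x)]
      have h3 := abs_rpow_taylor hq h2 h1
      rw [← hL] at h3
      calc _ ≤ L * (M s x - M t x) ^ 2 * ρ x := mul_le_mul_of_nonneg_right h3 (hρ.nonneg x)
        _ ≤ L * (M s x - M t x) ^ 2 * R :=
          mul_le_mul_of_nonneg_left (hR x) ((abs_nonneg _).trans h3)
        _ = _ := by ring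
  have := hrem.add hlin
  rw [zero_add, hinner] at this
  refine this.congr (fun s _ => ?_) ?_ <;> simp

theorem EnergyWeight.integrable_abs_rpow_mul {q B κ : ℝ} (hq : 2 ≤ q) {ρ m : ℝ → ℝ}
    (hρ : EnergyWeight κ ρ) (hm : Continuous m) (hB : ∀ x, |m x| ≤ B) :
    Integrable fun x => |m x| ^ q * ρ x := by
  rw [← memLp_one_iff_integrable]
  refine memLp_bdd_mul (C := B ^ q) (memLp_one_iff_integrable.mpr hρ.integrable)
    ((contDiff_abs_rpow hq).continuous.comp hm).aestronglyMeasurable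
    (Filter.Eventually.of_forall fun x => ?_)
  rw [abs_of_nonneg (by positivity)]
  exact Real.rpow_le_rpow (abs_nonneg _) (hB x) (by linarith)

theorem EnergyWeight.integrable_powDeriv_mul {q B κ : ℝ} (hq : 2 ≤ q) {ρ m g : ℝ → ℝ}
    (hρ : EnergyWeight κ ρ) (hm : Continuous m) (hB : ∀ x, |m x| ≤ B) (hg : MemLp g 2 volume) :
    Integrable fun x => powDeriv q (m x) * g x * ρ x := by
  have h : MemLp (fun x => powDeriv q (m x) * ρ x) 2 volume := by
    refine memLp_bdd_mul (C := q * B ^ (q - 1)) hρ.memLp_two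
      ((continuous_powDeriv hq).comp hm).aestronglyMeasurable
      (Filter.Eventually.of_forall fun x => ?_)
    rw [abs_powDeriv hq]
    have := hB x
    gcongr
    linarith
  refine (h.integrable_mul hg).congr (Filter.Eventually.of_forall fun x => ?_)
  simp only [Pi.mul_apply]; ring

/-- The contribution of the transport term to the weighted energy. -/
theorem EnergyWeight.neg_integral_transport_le {q A B κ : ℝ} (hq : 2 ≤ q) {ρ m m' U U' : ℝ → ℝ}
    (hρ : EnergyWeight κ ρ) (hm : IsPrimitive m m') (hB : ∀ x, |m x| ≤ B)
    (hm' : MemLp m' 2 volume) (hU : ∀ x, HasDerivAt U (U' x) x) (hUc : Continuous U')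
    (hUA : ∀ x, |U x| ≤ A) (hUA' : ∀ x, |U' x| ≤ A) :
    Integrable (fun x => powDeriv q (m x) * (U x * m' x) * ρ x) ∧
    -∫ x, powDeriv q (m x) * (U x * m' x) * ρ x ≤ A * (1 + κ) * ∫ x, |m x| ^ q * ρ x := by
  have hA : 0 ≤ A := (abs_nonneg _).trans (hUA 0)
  have hUcont : Continuous U := continuous_iff_continuousAt.mpr fun x => (hU x).continuousAt
  have hUC1 : ContDiff ℝ 1 U := by
    rw [contDiff_one_iff_deriv]
    refine ⟨fun x => (hU x).differentiableAt, ?_⟩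
    rwa [show deriv U = U' from funext fun x => (hU x).deriv]
  have hmc := hm.continuous
  -- `H'` is the transport integrand plus `J`, and `∫ H' = 0` because `H` is absolutely continuous
  -- and vanishes at both ends. Thus the integral to be bounded is `∫ J`, in which no derivative
  -- falls on `m`.
  set H : ℝ → ℝ := fun x => (|m x| ^ q * U x) * ρ x with hH
  have hΦ := hρ.integrable_abs_rpow_mul hq hmc hB
  have hI1 : Integrable (fun x => powDeriv q (m x) * (U x * m' x) * ρ x) :=
    hρ.integrable_powDeriv_mul hq hmc hB (memLp_bdd_mul hm' hUcont.aestronglyMeasurable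
      (Filter.Eventually.of_forall hUA))
  refine ⟨hI1, ?_⟩
  set J : ℝ → ℝ := fun x => |m x| ^ q * (U' x * ρ x + U x * deriv ρ x) with hJ
  have hJle : ∀ᵐ x, ‖J x‖ ≤ A * (1 + κ) * (|m x| ^ q * ρ x) := by
    filter_upwards [hρ.ae_deriv_le] with x hx
    have h1 : |U' x * ρ x + U x * deriv ρ x| ≤ A * ρ x + A * (κ * ρ x) := by
      refine (abs_add_le _ _).trans ?_
      rw [abs_mul, abs_mul, abs_of_nonneg (hρ.nonneg x)]
      exact add_le_add (mul_le_mul_of_nonneg_right (hUA' x) (hρ.nonneg x))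
        (mul_le_mul (hUA x) hx.2 (abs_nonneg _) hA)
    have h0 : 0 ≤ |m x| ^ q := by positivity
    rw [hJ, norm_mul, Real.norm_eq_abs, Real.norm_eq_abs, abs_of_nonneg h0]
    calc _ ≤ |m x| ^ q * (A * ρ x + A * (κ * ρ x)) := by gcongr
      _ = _ := by ring
  have hJi : Integrable J := by
    refine (hΦ.const_mul (A * (1 + κ))).mono' ?_ hJle
    refine ((contDiff_abs_rpow hq).continuous.comp hmc).aestronglyMeasurable.mul ?_
    refine (hUc.mul hρ.continuous).aestronglyMeasurable.add ?_
    exact hUcont.aestronglyMeasurable.mul (aestronglyMeasurable_deriv ρ _)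
  have hHd : ∀ᵐ x, deriv H x = powDeriv q (m x) * (U x * m' x) * ρ x + J x := by
    filter_upwards [hm.ae_hasDerivAt, hρ.ae_deriv_le] with x h1 h2
    have h3 := (((hasDerivAt_abs_rpow_powDeriv hq (m x)).comp x h1).mul (hU x)).mul h2.1.hasDerivAt
    have h4 : deriv H x = _ := h3.deriv
    rw [h4, hJ]
    simp only [Function.comp_apply, Pi.mul_apply]
    ring
  have hHi : Integrable (deriv H) := (hI1.add hJi).congr (hHd.mono fun x hx => hx.symm)
  have hHac : ∀ a b, AbsolutelyContinuousOnInterval H a b := fun a b =>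
    (((hm.absolutelyContinuousOnInterval a b).comp_contDiff (contDiff_abs_rpow hq)).fun_mul
      hUC1.contDiffOn.absolutelyContinuousOnInterval).fun_mul
      (hρ.absolutelyContinuousOnInterval a b)
  have hHle : ∀ x, ‖H x‖ ≤ (B ^ q * A) * ρ x := fun x => by
    rw [hH, norm_mul, norm_mul, Real.norm_eq_abs, Real.norm_eq_abs, Real.norm_eq_abs,
      abs_of_nonneg (hρ.nonneg x), abs_of_nonneg (by positivity : 0 ≤ |m x| ^ q)]
    have h1 : |m x| ^ q ≤ B ^ q := Real.rpow_le_rpow (abs_nonneg _) (hB x) (by linarith)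
    have h2 := hUA x
    have h3 := hρ.nonneg x
    gcongr
    exact le_trans (by positivity) h1
  have hHtop : Tendsto H atTop (𝓝 0) :=
    squeeze_zero_norm hHle (by simpa using hρ.tendsto_atTop.const_mul (B ^ q * A))
  have hHbot : Tendsto H atBot (𝓝 0) :=
    squeeze_zero_norm hHle (by simpa using hρ.tendsto_atBot.const_mul (B ^ q * A))
  have hzero : ∫ x, deriv H x = 0 := by
    have h1 := intervalIntegral_tendsto_integral hHi tendsto_neg_atTop_atBot tendsto_id
    have h2 : Tendsto (fun R : ℝ => ∫ x in (-R)..R, deriv H x) atTop (𝓝 (0 - 0)) := by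
      refine (hHtop.sub (hHbot.comp tendsto_neg_atTop_atBot)).congr fun R => ?_
      rw [(hHac (-R) R).integral_deriv_eq_sub]
      rfl
    rw [sub_zero] at h2
    exact tendsto_nhds_unique h1 h2
  rw [integral_congr_ae hHd, integral_add hI1 hJi] at hzero
  have hle : ∫ x, J x ≤ ∫ x, A * (1 + κ) * (|m x| ^ q * ρ x) :=
    integral_mono_ae hJi (hΦ.const_mul _) (hJle.mono fun x hx => (le_abs_self _).trans hx)
  rw [integral_const_mul] at hle
  linarith

/-- Transport with speed at most `3B` costs `3B(1+κ)`. In `6qB`, the coefficient `2u_x + v_x + w_x`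
accounts for `4qB` and the `m`-part of the two coupling terms for `qB` each; their other parts are
the `n` and `l` energies. -/
theorem EnergyWeight.energy_production_le {q B κ : ℝ} (hq : 2 ≤ q) {ρ u v w ut : ℝ → ℝ}
    (hρ : EnergyWeight κ ρ) (hu : RegularProfile B u) (hv : RegularProfile B v)
    (hw : RegularProfile B w) (heq : SatisfiesEquation u v w ut)
    (hut : MemLp (potential ut) 2 volume) :
    ∫ x, powDeriv q (potential u x) * potential ut x * ρ x ≤
      (3 * B * (1 + κ) + 6 * q * B) * (∫ x, |potential u x| ^ q * ρ x) +
      q * B * (∫ x, |potential v x| ^ q * ρ x) + q * B * ∫ x, |potential w x| ^ q * ρ x := by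
  have hB : 0 ≤ B := (abs_nonneg _).trans (hu.abs_le 0)
  have tri : ∀ {a b c : ℝ}, |a| ≤ B → |b| ≤ B → |c| ≤ B → |a + b + c| ≤ 3 * B := by
    intro a b c ha hb hc
    have := abs_add_three a b c
    linarith
  have hderiv_cont : ∀ {f : ℝ → ℝ}, RegularProfile B f → Continuous (deriv f) := fun hf =>
    continuous_iff_continuousAt.mpr fun x => (hf.hasDerivAt_deriv x).continuousAt
  obtain ⟨hi, hle⟩ := hρ.neg_integral_transport_le (A := 3 * B) hq hu.isPrimitive_potential
    hu.abs_potential_le hu.memLp_deriv_potential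
    (U := fun x => u x + v x + w x) (U' := fun x => deriv u x + deriv v x + deriv w x)
    (fun x => ((hu.hasDerivAt x).add (hv.hasDerivAt x)).add (hw.hasDerivAt x))
    (((hderiv_cont hu).add (hderiv_cont hv)).add (hderiv_cont hw))
    (fun x => tri (hu.abs_le x) (hv.abs_le x) (hw.abs_le x))
    (fun x => tri (hu.abs_deriv_le x) (hv.abs_deriv_le x) (hw.abs_deriv_le x))
  have iu := hρ.integrable_abs_rpow_mul hq hu.isPrimitive_potential.continuous hu.abs_potential_le
  have iv := hρ.integrable_abs_rpow_mul hq hv.isPrimitive_potential.continuous hv.abs_potential_le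
  have iw := hρ.integrable_abs_rpow_mul hq hw.isPrimitive_potential.continuous hw.abs_potential_le
  have hpt : ∀ᵐ x, powDeriv q (potential u x) * potential ut x * ρ x ≤
      -(powDeriv q (potential u x) * ((u x + v x + w x) * deriv (potential u) x) * ρ x) +
      (6 * q * B * (|potential u x| ^ q * ρ x) + q * B * (|potential v x| ^ q * ρ x) +
        q * B * (|potential w x| ^ q * ρ x)) := by
    filter_upwards [heq, hu.isPrimitive_potential.ae_hasDerivAt] with x hx hd
    have hprod : deriv (fun y => potential u y * v y + potential u y * w y) x =
        (deriv (potential u) x * v x + potential u x * deriv v x) +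
        (deriv (potential u) x * w x + potential u x * deriv w x) :=
      ((hd.mul (hv.hasDerivAt x)).add (hd.mul (hw.hasDerivAt x))).deriv
    rw [hprod] at hx
    set m := potential u x
    set n := potential v x
    set l := potential w x
    set ψ := powDeriv q m
    -- The products `m_x u`, `m_x v`, `m_x w` are gathered into one transport term; everything else
    -- is of order zero in the potentials.
    have e : potential ut x = -((u x + v x + w x) * deriv (potential u) x) -
        (m * (2 * deriv u x + deriv v x + deriv w x) + n * deriv v x + l * deriv w x) := by
      linear_combination hx
    have hψm : |ψ| * |m| = q * |m| ^ q := by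
      rw [← abs_mul, powDeriv_mul_self hq, abs_of_nonneg]
      have : 0 ≤ |m| ^ q := by positivity
      nlinarith
    have b1 : |2 * deriv u x + deriv v x + deriv w x| ≤ 4 * B := by
      have := abs_add_three (2 * deriv u x) (deriv v x) (deriv w x)
      rw [abs_mul, abs_two] at this
      linarith [hu.abs_deriv_le x, hv.abs_deriv_le x, hw.abs_deriv_le x]
    have t1 : |ψ * (m * (2 * deriv u x + deriv v x + deriv w x))| ≤ 4 * B * (q * |m| ^ q) := by
      rw [abs_mul, abs_mul, ← mul_assoc, hψm, mul_comm]
      refine mul_le_mul_of_nonneg_right b1 ?_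
      rw [← hψm]; positivity
    have t2 : |ψ * (n * deriv v x)| ≤ B * (q * (|m| ^ q + |n| ^ q)) := by
      rw [abs_mul, abs_mul, ← mul_assoc, mul_comm]
      exact mul_le_mul (hv.abs_deriv_le x) (abs_powDeriv_mul_le hq m n) (by positivity) hB
    have t3 : |ψ * (l * deriv w x)| ≤ B * (q * (|m| ^ q + |l| ^ q)) := by
      rw [abs_mul, abs_mul, ← mul_assoc, mul_comm]
      exact mul_le_mul (hw.abs_deriv_le x) (abs_powDeriv_mul_le hq m l) (by positivity) hB
    have h1 := (abs_le.mp t1).1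
    have h2 := (abs_le.mp t2).1
    have h3 := (abs_le.mp t3).1
    have key : ψ * potential ut x ≤ -(ψ * ((u x + v x + w x) * deriv (potential u) x)) +
        (6 * q * B * |m| ^ q + q * B * |n| ^ q + q * B * |l| ^ q) := by
      rw [e]
      linarith
    have := mul_le_mul_of_nonneg_right key (hρ.nonneg x)
    linarith
  have hint := integral_mono_ae
    (hρ.integrable_powDeriv_mul hq hu.isPrimitive_potential.continuous hu.abs_potential_le hut)
    (hi.neg.add (((iu.const_mul (6 * q * B)).add (iv.const_mul (q * B))).add
      (iw.const_mul (q * B)))) hpt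
  have esum : ∫ x, ((-fun x => powDeriv q (potential u x) *
        ((u x + v x + w x) * deriv (potential u) x) * ρ x) +
      (((fun x => 6 * q * B * (|potential u x| ^ q * ρ x)) +
        fun x => q * B * (|potential v x| ^ q * ρ x)) +
        fun x => q * B * (|potential w x| ^ q * ρ x))) x =
      -(∫ x, powDeriv q (potential u x) * ((u x + v x + w x) * deriv (potential u) x) * ρ x) +
      (6 * q * B * (∫ x, |potential u x| ^ q * ρ x) + q * B * (∫ x, |potential v x| ^ q * ρ x) +
        q * B * ∫ x, |potential w x| ^ q * ρ x) := by
    rw [integral_add' hi.neg (((iu.const_mul (6 * q * B)).add (iv.const_mul (q * B))).add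
        (iw.const_mul (q * B))), integral_add' ((iu.const_mul (6 * q * B)).add
        (iv.const_mul (q * B))) (iw.const_mul (q * B)), integral_add' (iu.const_mul (6 * q * B))
        (iv.const_mul (q * B)), integral_neg', integral_const_mul, integral_const_mul,
        integral_const_mul]
  have hint' := hint.trans_eq esum
  linarith

/-! ### The energy inequality along a solution. -/

theorem Icc_subset_timeInterval {T : EReal} {T' : ℝ} (hT' : T' ∈ timeInterval T) :
    Icc 0 T' ⊆ timeInterval T := fun _ ht =>
  ⟨ht.1, lt_of_le_of_lt (EReal.coe_le_coe_iff.mpr ht.2) hT'.2⟩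

theorem InStrongClass.exists_regularProfile {s : ℝ} (hs : 3 ≤ s) {I K : Set ℝ} {u u' : ℝ → ℝ → ℝ}
    (h : InStrongClass s I u u') (hK : IsCompact K) (hKI : K ⊆ I) :
    ∃ B, 0 ≤ B ∧ ∀ t ∈ K, RegularProfile B (u t) := by
  obtain ⟨F, hF, hc⟩ := h.continuousInHs
  obtain ⟨B, hB⟩ := hK.exists_bound_of_continuousOn (hc.mono hKI)
  refine ⟨4 * max B 0, by positivity, fun t ht => ?_⟩
  refine ((hF t (hKI ht)).regularProfile hs (h.continuous_rep t (hKI ht))).mono ?_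
  have := (hB t ht).trans (le_max_left B 0)
  linarith

/-- The weighted energy `∫ (|m|^q + |n|^q + |l|^q) ρ`. -/
def weightedEnergy (q : ℝ) (ρ m n l : ℝ → ℝ) : ℝ :=
  (∫ x, |m x| ^ q * ρ x) + (∫ x, |n x| ^ q * ρ x) + ∫ x, |l x| ^ q * ρ x

theorem InStrongClass.exists_hasDerivWithinAt_energy {s : ℝ} (hs : 3 ≤ s) {I K : Set ℝ}
    {u u' : ℝ → ℝ → ℝ} (h : InStrongClass s I u u') (hKI : K ⊆ I) {B q κ : ℝ} {ρ : ℝ → ℝ}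
    (hB : ∀ t ∈ K, RegularProfile B (u t)) (hq : 2 ≤ q) (hρ : EnergyWeight κ ρ) :
    (∀ t ∈ K, MemLp (potential (u' t)) 2 volume) ∧ ∀ t ∈ K,
    HasDerivWithinAt (fun t => ∫ x, |potential (u t) x| ^ q * ρ x)
      (∫ x, powDeriv q (potential (u t) x) * potential (u' t) x * ρ x) K t := by
  obtain ⟨M, M', hM, hM', hd⟩ := h.hasDerivInHs.hasDerivWithinAt_potential (by linarith)
    h.continuous_rep h.continuous_rep_deriv
  refine ⟨fun t ht => (Lp.memLp (M' t)).ae_eq (hM' t (hKI ht)), fun t ht => ?_⟩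
  have e : ∀ r ∈ K, ∫ x, |potential (u r) x| ^ q * ρ x = ∫ x, |M r x| ^ q * ρ x := fun r hr => by
    refine integral_congr_ae ?_
    filter_upwards [hM r (hKI hr)] with x hx
    rw [hx]
  have e' : ∫ x, powDeriv q (potential (u t) x) * potential (u' t) x * ρ x =
      ∫ x, powDeriv q (M t x) * M' t x * ρ x := by
    refine integral_congr_ae ?_
    filter_upwards [hM t (hKI ht), hM' t (hKI ht)] with x hx hx'
    rw [hx, hx']
  rw [e']
  refine (hasDerivWithinAt_integral_abs_rpow (B := B) hq hρ (fun r hr => ?_) ht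
    ((hd t (hKI ht)).mono hKI)).congr e (e t ht)
  filter_upwards [hM r (hKI hr)] with x hx
  rw [hx]
  exact (hB r hr).abs_potential_le x

theorem le_exp_mul_of_hasDerivWithinAt_le {E E' : ℝ → ℝ} {k T' : ℝ}
    (hE : ∀ t ∈ Icc 0 T', HasDerivWithinAt E (E' t) (Icc 0 T') t)
    (hle : ∀ t ∈ Icc 0 T', E' t ≤ k * E t) {t : ℝ} (ht : t ∈ Icc 0 T') :
    E t ≤ Real.exp (k * t) * E 0 := by
  have hd : ∀ t ∈ Icc 0 T', HasDerivWithinAt (fun t => Real.exp (-(k * t)) * E t)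
      (Real.exp (-(k * t)) * (E' t - k * E t)) (Icc 0 T') t := fun t ht => by
    have h1 : HasDerivAt (fun t => Real.exp (-(k * t))) (Real.exp (-(k * t)) * -(k * 1)) t :=
      (((hasDerivAt_id t).const_mul k).neg).exp
    exact (h1.hasDerivWithinAt.mul (hE t ht)).congr_deriv (by ring)
  have hanti := antitoneOn_of_hasDerivWithinAt_nonpos (convex_Icc 0 T')
    (fun t ht => (hd t ht).continuousWithinAt)
    (fun t ht => (hd t (interior_subset ht)).mono interior_subset)
    (fun t ht => mul_nonpos_of_nonneg_of_nonpos (Real.exp_pos _).le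
      (sub_nonpos.mpr (hle t (interior_subset ht))))
  have h := hanti (left_mem_Icc.mpr (ht.1.trans ht.2)) ht ht.1
  simp only [mul_zero, neg_zero, Real.exp_zero, one_mul] at h
  calc E t = Real.exp (k * t) * (Real.exp (-(k * t)) * E t) := by
        rw [← mul_assoc, ← Real.exp_add]; simp
    _ ≤ _ := by gcongr

/-- With `κ = q a`, each component gets `3B + 3qaB + 6qB` from its own equation and `qB` from each
of the other two. `B` is chosen before `q`, `a` and `ρ`. -/
theorem IsStrongSolution.exists_energy_le {s : ℝ} (hs : 3 ≤ s) {T : EReal} {u₀ v₀ w₀ : ℝ → ℝ}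
    {u v w : ℝ → ℝ → ℝ} (hsol : IsStrongSolution s T u₀ v₀ w₀ u v w) {T' : ℝ}
    (hT' : T' ∈ timeInterval T) :
    ∃ B, 0 ≤ B ∧ (∀ t ∈ Icc 0 T', RegularProfile B (u t) ∧ RegularProfile B (v t) ∧
      RegularProfile B (w t)) ∧
      ∀ q a : ℝ, 2 ≤ q → 0 ≤ a → ∀ ρ : ℝ → ℝ, EnergyWeight (q * a) ρ → ∀ t ∈ Icc 0 T',
        weightedEnergy q ρ (potential (u t)) (potential (v t)) (potential (w t)) ≤
          Real.exp (q * (B * (11 + 3 * a)) * t) *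
            weightedEnergy q ρ (potential u₀) (potential v₀) (potential w₀) := by
  obtain ⟨⟨rfl, rfl, rfl⟩, u', v', w', hu, hv, hw, heq⟩ := hsol
  have hsub := Icc_subset_timeInterval hT'
  obtain ⟨B₁, hB₁, h₁⟩ := hu.exists_regularProfile hs isCompact_Icc hsub
  obtain ⟨B₂, hB₂, h₂⟩ := hv.exists_regularProfile hs isCompact_Icc hsub
  obtain ⟨B₃, hB₃, h₃⟩ := hw.exists_regularProfile hs isCompact_Icc hsub
  set B := B₁ + B₂ + B₃
  have hB : 0 ≤ B := by positivity
  replace h₁ : ∀ t ∈ Icc 0 T', RegularProfile B (u t) := fun t ht => (h₁ t ht).mono (by linarith)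
  replace h₂ : ∀ t ∈ Icc 0 T', RegularProfile B (v t) := fun t ht => (h₂ t ht).mono (by linarith)
  replace h₃ : ∀ t ∈ Icc 0 T', RegularProfile B (w t) := fun t ht => (h₃ t ht).mono (by linarith)
  refine ⟨B, hB, fun t ht => ⟨h₁ t ht, h₂ t ht, h₃ t ht⟩, fun q a hq ha ρ hρ t ht => ?_⟩
  obtain ⟨mu, du⟩ := hu.exists_hasDerivWithinAt_energy hs hsub h₁ hq hρ
  obtain ⟨mv, dv⟩ := hv.exists_hasDerivWithinAt_energy hs hsub h₂ hq hρ
  obtain ⟨mw, dw⟩ := hw.exists_hasDerivWithinAt_energy hs hsub h₃ hq hρ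
  refine le_exp_mul_of_hasDerivWithinAt_le
    (E := fun t => weightedEnergy q ρ (potential (u t)) (potential (v t)) (potential (w t)))
    (fun t ht => ((du t ht).add (dv t ht)).add (dw t ht)) (fun t ht => ?_) ht
  obtain ⟨eu, ev, ew⟩ := heq t (hsub ht)
  have pu := hρ.energy_production_le hq (h₁ t ht) (h₂ t ht) (h₃ t ht) eu (mu t ht)
  have pv := hρ.energy_production_le hq (h₂ t ht) (h₁ t ht) (h₃ t ht) ev (mv t ht)
  have pw := hρ.energy_production_le hq (h₃ t ht) (h₁ t ht) (h₂ t ht) ew (mw t ht)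
  have nn : ∀ f : ℝ → ℝ, 0 ≤ ∫ x, |f x| ^ q * ρ x := fun f =>
    integral_nonneg fun x => mul_nonneg (by positivity) (hρ.nonneg x)
  -- Absorbing `3B` into `3qB` makes the rate exactly proportional to `q`, whence `11 = 3 + 6 + 2`.
  have hBq : B ≤ q * B := by nlinarith
  have slack : ∀ f : ℝ → ℝ, 3 * B * ∫ x, |f x| ^ q * ρ x ≤ 3 * (q * B) * ∫ x, |f x| ^ q * ρ x :=
    fun f => mul_le_mul_of_nonneg_right (by linarith) (nn f)
  have su := slack (potential (u t))
  have sv := slack (potential (v t))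
  have sw := slack (potential (w t))
  unfold weightedEnergy
  linarith

/-! ### Tent weights. -/

theorem integrable_exp_neg_mul_abs {c : ℝ} (hc : 0 < c) :
    Integrable fun x : ℝ => Real.exp (-(c * |x|)) := by
  rw [← integrableOn_univ, ← Iic_union_Ioi (a := (0:ℝ))]
  refine IntegrableOn.union ?_ ?_
  · refine (integrableOn_exp_mul_Iic hc 0).congr_fun (fun x hx => ?_) measurableSet_Iic
    simp only [abs_of_nonpos (mem_Iic.mp hx)]
    ring_nf
  · refine (exp_neg_integrableOn_Ioi 0 hc).congr_fun (fun x hx => ?_) measurableSet_Ioi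
    simp only [abs_of_pos (mem_Ioi.mp hx)]
    ring_nf

/-- The Lipschitz exponent that equals `a|x|` for `|x| ≤ N` and decreases with slope `a` beyond. -/
def tent (a N x : ℝ) : ℝ := a * min |x| (2 * N - |x|)

theorem tent_of_abs_le {a N x : ℝ} (h : |x| ≤ N) : tent a N x = a * |x| := by
  unfold tent
  rw [min_eq_left (by linarith)]

theorem tent_le {a N : ℝ} (ha : 0 ≤ a) (x : ℝ) : tent a N x ≤ a * |x| :=
  mul_le_mul_of_nonneg_left (min_le_left _ _) ha

theorem tent_le' {a N : ℝ} (ha : 0 ≤ a) (x : ℝ) : tent a N x ≤ a * (2 * N - |x|) :=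
  mul_le_mul_of_nonneg_left (min_le_right _ _) ha

theorem lipschitzWith_tent {a : ℝ} (ha : 0 ≤ a) (N : ℝ) : LipschitzWith a.toNNReal (tent a N) := by
  have h1 : LipschitzWith 1 (fun x : ℝ => |x|) :=
    LipschitzWith.of_dist_le_mul fun x y => by
      simpa [Real.dist_eq] using abs_abs_sub_abs_le_abs_sub x y
  have h2 : LipschitzWith 1 (fun x : ℝ => 2 * N - |x|) :=
    LipschitzWith.of_dist_le_mul fun x y => by
      have := abs_abs_sub_abs_le_abs_sub y x
      rw [abs_sub_comm y x] at this
      rw [Real.dist_eq, Real.dist_eq, NNReal.coe_one, one_mul,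
        show 2 * N - |x| - (2 * N - |y|) = |y| - |x| by ring]
      exact this
  have h3 := h1.min h2
  rw [max_self] at h3
  refine LipschitzWith.of_dist_le_mul fun x y => ?_
  have := h3.dist_le_mul x y
  simp only [tent, Real.dist_eq, NNReal.coe_one, one_mul, Real.coe_toNNReal a ha] at this ⊢
  rw [← mul_sub, abs_mul, abs_of_nonneg ha]
  gcongr

/-- The slope of the tent is at most `a` in absolute value, so `κ = q a` for every `N`. The
descending sides give integrability, which a cut-off at a constant height would not. -/
theorem energyWeight_exp_tent {q a N : ℝ} (hq : 0 < q) (ha : 0 < a) :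
    EnergyWeight (q * a) fun x => Real.exp (q * tent a N x) := by
  have hL := lipschitzWith_tent ha.le N
  have hc : Continuous fun x => Real.exp (q * tent a N x) :=
    Real.continuous_exp.comp (continuous_const.mul hL.continuous)
  have hqa : 0 < q * a := mul_pos hq ha
  have hle : ∀ x, Real.exp (q * tent a N x) ≤
      Real.exp (q * (a * (2 * N))) * Real.exp (-(q * a * |x|)) := fun x => by
    rw [← Real.exp_add]
    have := mul_le_mul_of_nonneg_left (tent_le' (N := N) ha.le x) hq.le
    exact Real.exp_le_exp.mpr (by linarith)
  refine ⟨fun x => (Real.exp_pos _).le, hc, ⟨Real.exp (q * (a * (2 * N))), fun x => ?_⟩, ?_, ?_, ?_,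
    ?_, ?_⟩
  · refine (hle x).trans (mul_le_of_le_one_right (Real.exp_pos _).le ?_)
    exact Real.exp_le_one_iff.mpr (neg_nonpos.mpr (by positivity))
  · refine ((integrable_exp_neg_mul_abs hqa).const_mul (Real.exp (q * (a * (2 * N))))).mono'
      hc.aestronglyMeasurable
      (Filter.Eventually.of_forall fun x => ?_)
    rw [Real.norm_eq_abs, abs_of_pos (Real.exp_pos _)]
    exact hle x
  · intro b c
    exact (hL.lipschitzOnWith.absolutelyContinuousOnInterval).comp_contDiff
      (g := fun y => Real.exp (q * y)) (by fun_prop)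
  · filter_upwards [hL.ae_differentiableAt_real] with x hx
    have h1 : HasDerivAt (fun x => Real.exp (q * tent a N x)) _ x := (hx.hasDerivAt.const_mul q).exp
    refine ⟨h1.differentiableAt, ?_⟩
    have h2 : |deriv (tent a N) x| ≤ a := by
      simpa [Real.coe_toNNReal a ha.le] using norm_deriv_le_of_lipschitz (x₀ := x) hL
    rw [h1.deriv, abs_mul, abs_mul, abs_of_pos (Real.exp_pos _), abs_of_pos hq, mul_comm]
    gcongr
  · refine squeeze_zero (fun x => (Real.exp_pos _).le) hle ?_
    rw [← mul_zero (Real.exp (q * (a * (2 * N))))]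
    exact (Real.tendsto_exp_neg_atTop_nhds_zero.comp
      (tendsto_abs_atTop_atTop.const_mul_atTop hqa)).const_mul _
  · refine squeeze_zero (fun x => (Real.exp_pos _).le) hle ?_
    rw [← mul_zero (Real.exp (q * (a * (2 * N))))]
    exact (Real.tendsto_exp_neg_atTop_nhds_zero.comp
      (tendsto_abs_atBot_atTop.const_mul_atTop hqa)).const_mul _

/-! ### From tent energies to weighted norms and pointwise bounds. -/

section Norms

variable {q a D B : ℝ} {f : ℝ → ℝ}

theorem ofReal_abs_rpow_mul_exp (hq : 0 < q) (y z : ℝ) :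
    ENNReal.ofReal (|y| ^ q * Real.exp (q * z)) = ‖y * Real.exp z‖ₑ ^ q := by
  rw [← ofReal_norm, norm_mul, Real.norm_eq_abs, Real.norm_eq_abs, abs_of_pos (Real.exp_pos z),
    ENNReal.ofReal_rpow_of_nonneg (by positivity) hq.le,
    Real.mul_rpow (abs_nonneg _) (Real.exp_pos _).le, ← Real.exp_mul, mul_comm z q]

theorem eLpNorm_rpow_eq (hq : 0 < q) (g : ℝ → ℝ) :
    eLpNorm g (ENNReal.ofReal q) volume ^ q = ∫⁻ x, ‖g x‖ₑ ^ q := by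
  rw [eLpNorm_eq_lintegral_rpow_enorm_toReal (by simpa using hq) ENNReal.ofReal_ne_top,
    ENNReal.toReal_ofReal hq.le, ← ENNReal.rpow_mul, one_div, inv_mul_cancel₀ hq.ne',
    ENNReal.rpow_one]

theorem integral_abs_rpow_mul_tent_le (hq : 0 < q) (ha : 0 ≤ a) (hD : 0 ≤ D) (hf : Continuous f)
    (h : eLpNorm (fun x => f x * Real.exp (a * |x|)) (ENNReal.ofReal q) volume ≤ ENNReal.ofReal D)
    (N : ℝ) : ∫ x, |f x| ^ q * Real.exp (q * tent a N x) ≤ D ^ q := by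
  have hc : Continuous fun x => |f x| ^ q * Real.exp (q * tent a N x) :=
    (hf.abs.rpow_const fun _ => Or.inr hq.le).mul
      (Real.continuous_exp.comp (continuous_const.mul (lipschitzWith_tent ha N).continuous))
  rw [integral_eq_lintegral_of_nonneg_ae (Filter.Eventually.of_forall fun x => by positivity)
    hc.aestronglyMeasurable]
  refine ENNReal.toReal_le_of_le_ofReal (by positivity) ?_
  calc _ ≤ ∫⁻ x, ‖f x * Real.exp (a * |x|)‖ₑ ^ q := by
        refine lintegral_mono fun x => ?_
        rw [← ofReal_abs_rpow_mul_exp hq]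
        refine ENNReal.ofReal_le_ofReal ?_
        gcongr
        exact tent_le ha x
    _ = _ := (eLpNorm_rpow_eq hq _).symm
    _ ≤ ENNReal.ofReal D ^ q := ENNReal.rpow_le_rpow h hq.le
    _ = _ := ENNReal.ofReal_rpow_of_nonneg hD hq.le

/-- Fatou's lemma: at a fixed `x` the tent equals `a|x|` as soon as `N ≥ |x|`. -/
theorem eLpNorm_exp_le_of_forall_tent (hq : 2 ≤ q) (ha : 0 < a) (hD : 0 ≤ D) (hf : Continuous f)
    (hB : ∀ x, |f x| ≤ B)
    (h : ∀ N : ℕ, ∫ x, |f x| ^ q * Real.exp (q * tent a N x) ≤ D ^ q) :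
    eLpNorm (fun x => f x * Real.exp (a * |x|)) (ENNReal.ofReal q) volume ≤ ENNReal.ofReal D := by
  have hq0 : 0 < q := by linarith
  rw [← ENNReal.rpow_le_rpow_iff hq0, eLpNorm_rpow_eq hq0, ENNReal.ofReal_rpow_of_nonneg hD hq0.le]
  have hlim : ∀ x, liminf (fun N : ℕ => ENNReal.ofReal (|f x| ^ q * Real.exp (q * tent a N x))) atTop
      = ‖f x * Real.exp (a * |x|)‖ₑ ^ q := fun x => by
    refine Tendsto.liminf_eq (tendsto_const_nhds.congr' ?_)
    filter_upwards [eventually_ge_atTop ⌈|x|⌉₊] with N hN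
    rw [tent_of_abs_le (Nat.ceil_le.mp hN), ofReal_abs_rpow_mul_exp hq0]
  simp_rw [← hlim]
  refine (lintegral_liminf_le fun N => ?_).trans ?_
  · exact (ENNReal.continuous_ofReal.comp ((hf.abs.rpow_const fun _ => Or.inr hq0.le).mul
      (Real.continuous_exp.comp (continuous_const.mul
        (lipschitzWith_tent ha.le N).continuous)))).measurable
  · refine liminf_le_of_le (by isBoundedDefault) fun b hb => ?_
    obtain ⟨N, hN⟩ := hb.exists
    refine hN.trans ?_
    rw [← ofReal_integral_eq_lintegral_ofReal
      ((energyWeight_exp_tent hq0 ha).integrable_abs_rpow_mul hq hf hB)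
      (Filter.Eventually.of_forall fun x => by positivity)]
    exact ENNReal.ofReal_le_ofReal (h N)

/-- `L^n` bounds of geometric growth give a pointwise bound. -/
theorem le_of_forall_integral_pow_le {g : ℝ → ℝ} {A : ℝ} (hg : Continuous g) (hg0 : ∀ x, 0 ≤ g x)
    (hA : 0 ≤ A) (hi : ∀ n : ℕ, 2 ≤ n → Integrable fun x => g x ^ n)
    (h : ∀ n : ℕ, 2 ≤ n → ∫ x, g x ^ n ≤ A ^ n * D) (x : ℝ) : g x ≤ A := by
  by_contra! hlt
  obtain ⟨A', hA', hA'x⟩ := exists_between hlt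
  obtain ⟨δ, hδ, hball⟩ := Metric.mem_nhds_iff.mp
    (hg.continuousAt.eventually (lt_mem_nhds hA'x))
  have hA'0 : 0 < A' := hA.trans_lt hA'
  -- If `g x > A`, then `g > A' > A` on a ball of length `2δ`; the right side tends to `0`, which
  -- contradicts `δ > 0`.
  have key : ∀ n : ℕ, 2 ≤ n → 2 * δ ≤ (A / A') ^ n * D := fun n hn => by
    have h1 : A' ^ n * (2 * δ) ≤ ∫ x, g x ^ n := by
      calc A' ^ n * (2 * δ) = ∫ _ in Metric.ball x δ, A' ^ n := by
            rw [setIntegral_const, Measure.real, Real.volume_ball,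
              ENNReal.toReal_ofReal (by linarith), smul_eq_mul, mul_comm]
        _ ≤ ∫ y in Metric.ball x δ, g y ^ n := by
            refine setIntegral_mono_on (integrableOn_const measure_ball_lt_top.ne) (hi n hn).integrableOn
              Metric.isOpen_ball.measurableSet fun y hy => ?_
            have : A' < g y := hball hy
            gcongr
        _ ≤ _ := setIntegral_le_integral (hi n hn)
            (Filter.Eventually.of_forall fun y => by have := hg0 y; positivity)
    have h2 := h1.trans (h n hn)
    rw [div_pow, div_mul_eq_mul_div, le_div_iff₀ (by positivity)]
    linarith
  have hlim : Tendsto (fun n : ℕ => (A / A') ^ n * D) atTop (𝓝 (0 * D)) :=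
    (tendsto_pow_atTop_nhds_zero_of_lt_one (by positivity)
      ((div_lt_one hA'0).mpr hA')).mul_const D
  have := ge_of_tendsto hlim (eventually_atTop.mpr ⟨2, key⟩)
  linarith

end Norms

/-! ### Decay of a function from decay of its potential. -/

/-- `(e^{-x}(u + u'))' = -e^{-x}(u - u'')` is integrated from `+∞`, where the boundary term
vanishes, and `(e^x(u - u'))' = e^x(u - u'')` from `0`. The second integral of `e^{(1-α)x}` produces
`C/(1-α)` and forces `α < 1`; `2B` bounds the value at `0`. Subtracting explicit exponentials turns
both integrations into monotonicity. -/
theorem half_line_decay {u u₁ u₂ : ℝ → ℝ} {B C α : ℝ} (hα : 0 < α) (hα1 : α < 1) (hC : 0 ≤ C)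
    (h₁ : ∀ x, HasDerivAt u (u₁ x) x) (h₂ : ∀ x, HasDerivAt u₁ (u₂ x) x)
    (hB : ∀ x, |u x| ≤ B) (hB₁ : ∀ x, |u₁ x| ≤ B)
    (hm : ∀ x, 0 ≤ x → u x - u₂ x ≤ C * Real.exp (-(α * x))) {x : ℝ} (hx : 0 ≤ x) :
    u x + u₁ x ≤ C * Real.exp (-(α * x)) ∧
    u x - u₁ x ≤ (2 * B + C / (1 - α)) * Real.exp (-(α * x)) := by
  have hB0 : 0 ≤ B := (abs_nonneg _).trans (hB 0)
  have hlin : ∀ (c y : ℝ), HasDerivAt (fun y => Real.exp (c * y)) (Real.exp (c * y) * c) y :=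
    fun c y => by simpa using ((hasDerivAt_id y).const_mul c).exp
  constructor
  · have hd : ∀ y, HasDerivAt
        (fun y => Real.exp (-1 * y) * (u y + u₁ y) - C * Real.exp (-(1 + α) * y))
        (-Real.exp (-1 * y) * (u y - u₂ y) + (1 + α) * C * Real.exp (-(1 + α) * y)) y := fun y =>
      (((hlin (-1) y).mul ((h₁ y).add (h₂ y))).sub ((hlin (-(1 + α)) y).const_mul C)).congr_deriv
        (by simp only [Pi.add_apply]; ring)
    have hmono : MonotoneOn
        (fun y => Real.exp (-1 * y) * (u y + u₁ y) - C * Real.exp (-(1 + α) * y)) (Ici 0) := by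
      refine monotoneOn_of_hasDerivWithinAt_nonneg (convex_Ici 0)
        (fun y _ => (hd y).continuousAt.continuousWithinAt)
        (fun y _ => (hd y).hasDerivWithinAt) (fun y hy => ?_)
      have hy0 : 0 ≤ y := interior_subset hy
      have e : Real.exp (-(1 + α) * y) = Real.exp (-1 * y) * Real.exp (-(α * y)) := by
        rw [← Real.exp_add]; ring_nf
      have h3 := mul_le_mul_of_nonneg_left (hm y hy0) (Real.exp_pos (-1 * y)).le
      have h4 : 0 ≤ α * C * (Real.exp (-1 * y) * Real.exp (-(α * y))) := by positivity
      rw [e]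
      linarith
    have hexp : ∀ c : ℝ, 0 < c → Tendsto (fun y : ℝ => Real.exp (-c * y)) atTop (𝓝 0) :=
      fun c hc => Real.tendsto_exp_atBot.comp (tendsto_id.const_mul_atTop_of_neg (neg_neg_of_pos hc))
    have hlim : Tendsto
        (fun y => Real.exp (-1 * y) * (u y + u₁ y) - C * Real.exp (-(1 + α) * y)) atTop (𝓝 0) := by
      have l1 : Tendsto (fun y => Real.exp (-1 * y) * (u y + u₁ y)) atTop (𝓝 0) := by
        refine squeeze_zero_norm (a := fun y => Real.exp (-1 * y) * (2 * B)) (fun y => ?_)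
          (by simpa using (hexp 1 one_pos).mul_const (2 * B))
        rw [norm_mul, Real.norm_eq_abs, Real.norm_eq_abs, abs_of_pos (Real.exp_pos _)]
        have := abs_add_le (u y) (u₁ y)
        have := hB y
        have := hB₁ y
        gcongr
        linarith
      simpa using l1.sub ((hexp (1 + α) (by linarith)).const_mul C)
    have hle := ge_of_tendsto hlim (eventually_atTop.mpr ⟨x, fun y hy =>
      hmono hx (hx.trans hy : (0:ℝ) ≤ y) hy⟩)
    have e : Real.exp (-(1 + α) * x) = Real.exp (-1 * x) * Real.exp (-(α * x)) := by
      rw [← Real.exp_add]; ring_nf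
    simp only [e] at hle
    have h5 : Real.exp (-1 * x) * (u x + u₁ x) ≤ Real.exp (-1 * x) * (C * Real.exp (-(α * x))) := by
      linarith
    exact le_of_mul_le_mul_left h5 (Real.exp_pos _)
  · have hα' : 0 < 1 - α := by linarith
    have hd : ∀ y, HasDerivAt
        (fun y => Real.exp (1 * y) * (u y - u₁ y) - C / (1 - α) * Real.exp ((1 - α) * y))
        (Real.exp (1 * y) * (u y - u₂ y) - C * Real.exp ((1 - α) * y)) y := fun y =>
      (((hlin 1 y).mul ((h₁ y).sub (h₂ y))).sub
        ((hlin (1 - α) y).const_mul (C / (1 - α)))).congr_deriv (by simp only [Pi.sub_apply]; field_simp; ring)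
    have hanti : AntitoneOn
        (fun y => Real.exp (1 * y) * (u y - u₁ y) - C / (1 - α) * Real.exp ((1 - α) * y))
        (Ici 0) := by
      refine antitoneOn_of_hasDerivWithinAt_nonpos (convex_Ici 0)
        (fun y _ => (hd y).continuousAt.continuousWithinAt)
        (fun y _ => (hd y).hasDerivWithinAt) (fun y hy => ?_)
      have hy0 : 0 ≤ y := interior_subset hy
      have e : Real.exp ((1 - α) * y) = Real.exp (1 * y) * Real.exp (-(α * y)) := by
        rw [← Real.exp_add]; ring_nf
      have h3 := mul_le_mul_of_nonneg_left (hm y hy0) (Real.exp_pos (1 * y)).le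
      rw [e]
      linarith
    have h0 := hanti (le_refl (0:ℝ)) hx hx
    simp only [mul_zero, Real.exp_zero, one_mul, mul_one] at h0
    have h4 : u 0 - u₁ 0 ≤ 2 * B := by
      linarith [(abs_le.mp (hB 0)).2, (abs_le.mp (hB₁ 0)).1]
    have h5 : 0 ≤ C / (1 - α) := by positivity
    have e : Real.exp ((1 - α) * x) = Real.exp x * Real.exp (-(α * x)) := by
      rw [← Real.exp_add]; ring_nf
    have h6 : 1 ≤ Real.exp x * Real.exp (-(α * x)) := by
      rw [← e]; exact Real.one_le_exp (by positivity)
    rw [e] at h0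
    have h7 : 2 * B ≤ 2 * B * (Real.exp x * Real.exp (-(α * x))) :=
      le_mul_of_one_le_right (by linarith) h6
    have h8 : Real.exp x * (u x - u₁ x) ≤
        Real.exp x * ((2 * B + C / (1 - α)) * Real.exp (-(α * x))) := by
      linarith
    exact le_of_mul_le_mul_left h8 (Real.exp_pos _)

/-- The one-sided bounds for `u` and `-u` control `u + u'` and `u - u'` in absolute value; half
their sum and half their difference are `u` and `u'`. -/
theorem half_line_abs_decay {u u₁ u₂ : ℝ → ℝ} {B C α : ℝ} (hα : 0 < α) (hα1 : α < 1) (hC : 0 ≤ C)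
    (h₁ : ∀ x, HasDerivAt u (u₁ x) x) (h₂ : ∀ x, HasDerivAt u₁ (u₂ x) x)
    (hB : ∀ x, |u x| ≤ B) (hB₁ : ∀ x, |u₁ x| ≤ B)
    (hm : ∀ x, 0 ≤ x → |u x - u₂ x| ≤ C * Real.exp (-(α * x))) {x : ℝ} (hx : 0 ≤ x) :
    |u x| ≤ (2 * B + C / (1 - α)) * Real.exp (-(α * x)) ∧
    |u₁ x| ≤ (2 * B + C / (1 - α)) * Real.exp (-(α * x)) := by
  have hB0 : 0 ≤ B := (abs_nonneg _).trans (hB 0)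
  obtain ⟨p1, p2⟩ := half_line_decay hα hα1 hC h₁ h₂ hB hB₁
    (fun y hy => (le_abs_self _).trans (hm y hy)) hx
  obtain ⟨n1, n2⟩ := half_line_decay (u := fun y => -u y) (u₁ := fun y => -u₁ y)
    (u₂ := fun y => -u₂ y) hα hα1 hC (fun y => (h₁ y).neg) (fun y => (h₂ y).neg)
    (fun y => by rw [abs_neg]; exact hB y) (fun y => by rw [abs_neg]; exact hB₁ y)
    (fun y hy => by linarith [(abs_le.mp (hm y hy)).1]) hx
  have hCle : C * Real.exp (-(α * x)) ≤ (2 * B + C / (1 - α)) * Real.exp (-(α * x)) := by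
    gcongr
    have : C ≤ C / (1 - α) := by
      rw [le_div_iff₀ (by linarith)]; nlinarith
    linarith
  constructor <;> rw [abs_le] <;> constructor <;> linarith

theorem RegularProfile.exp_decay {u : ℝ → ℝ} {B C α : ℝ} (hα : 0 < α) (hα1 : α < 1) (hC : 0 ≤ C)
    (hu : RegularProfile B u) (hm : ∀ x, |potential u x| ≤ C * Real.exp (-(α * |x|))) (x : ℝ) :
    |u x| ≤ (2 * B + C / (1 - α)) * Real.exp (-(α * |x|)) ∧
    |deriv u x| ≤ (2 * B + C / (1 - α)) * Real.exp (-(α * |x|)) := by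
  rcases le_total 0 x with hx | hx
  · rw [abs_of_nonneg hx]
    exact half_line_abs_decay hα hα1 hC hu.hasDerivAt hu.hasDerivAt_deriv hu.abs_le hu.abs_deriv_le
      (fun y hy => by have := hm y; rwa [abs_of_nonneg hy] at this) hx
  · rw [abs_of_nonpos hx]
    have h := half_line_abs_decay (u := fun y => u (-y)) (u₁ := fun y => -deriv u (-y))
      (u₂ := fun y => deriv (deriv u) (-y)) hα hα1 hC
      (fun y => by
        have := (hu.hasDerivAt (-y)).comp y (hasDerivAt_neg y)
        rwa [mul_neg_one] at this)
      (fun y => by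
        have := ((hu.hasDerivAt_deriv (-y)).comp y (hasDerivAt_neg y)).neg
        rwa [mul_neg_one, neg_neg] at this)
      (fun y => hu.abs_le _) (fun y => by rw [abs_neg]; exact hu.abs_deriv_le _)
      (fun y hy => by
        have := hm (-y)
        rwa [abs_neg, abs_of_nonneg hy] at this) (neg_nonneg.mpr hx)
    simpa using h

/-! ### Assembly of the two statements. -/

theorem ExpDecay.exists_bound {a : ℝ} {f : ℝ → ℝ} (h : ExpDecay a f) (hf : Continuous f) :
    ∃ C, 0 ≤ C ∧ ∀ x, |f x| ≤ C * Real.exp (-(a * |x|)) := by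
  obtain ⟨C, hC⟩ := h.bound
  obtain ⟨K, hK, hKC⟩ := mem_cocompact.mp hC
  obtain ⟨D, hD⟩ := hK.exists_bound_of_continuousOn (f := fun x => f x * Real.exp (a * |x|))
    (by fun_prop)
  refine ⟨max (max C D) 0, le_max_right _ _, fun x => ?_⟩
  by_cases hx : x ∈ K
  · have h1 := hD x hx
    rw [norm_mul, Real.norm_eq_abs, Real.norm_eq_abs, abs_of_pos (Real.exp_pos _)] at h1
    have h2 : |f x| = |f x| * Real.exp (a * |x|) * Real.exp (-(a * |x|)) := by
      rw [mul_assoc, ← Real.exp_add]; simp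
    rw [h2]
    gcongr
    exact h1.trans ((le_max_right C D).trans (le_max_left _ _))
  · have h1 : ‖f x‖ ≤ C * ‖Real.exp (-(a * |x|))‖ := hKC hx
    rw [Real.norm_eq_abs, Real.norm_eq_abs, abs_of_pos (Real.exp_pos _)] at h1
    refine h1.trans ?_
    gcongr
    exact (le_max_left C D).trans (le_max_left _ _)

theorem uniformExpDecay_of_forall_le {a T' C : ℝ} {f : ℝ → ℝ → ℝ}
    (h : ∀ t ∈ Icc 0 T', ∀ x, |f t x| ≤ C * Real.exp (-(a * |x|))) : UniformExpDecay a T' f := by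
  refine IsBigO.of_bound C ?_
  have : Icc (0:ℝ) T' ×ˢ (univ : Set ℝ) ∈ 𝓟 (Icc (0:ℝ) T') ×ˢ cocompact ℝ :=
    prod_mem_prod (mem_principal_self _) univ_mem
  filter_upwards [this] with z hz
  rw [Real.norm_eq_abs, Real.norm_eq_abs, abs_of_pos (Real.exp_pos _)]
  exact h z.1 hz.1 z.2

theorem weightedEnergy_nonneg_terms {q κ : ℝ} {ρ : ℝ → ℝ} (hρ : EnergyWeight κ ρ) (f : ℝ → ℝ) :
    0 ≤ ∫ x, |f x| ^ q * ρ x :=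
  integral_nonneg fun x => mul_nonneg (by positivity) (hρ.nonneg x)

theorem le_weightedEnergy {q κ : ℝ} {ρ : ℝ → ℝ} (hρ : EnergyWeight κ ρ) (m n l : ℝ → ℝ) :
    ∫ x, |m x| ^ q * ρ x ≤ weightedEnergy q ρ m n l ∧
    ∫ x, |n x| ^ q * ρ x ≤ weightedEnergy q ρ m n l ∧
    ∫ x, |l x| ^ q * ρ x ≤ weightedEnergy q ρ m n l := by
  have h1 := weightedEnergy_nonneg_terms (q := q) hρ m
  have h2 := weightedEnergy_nonneg_terms (q := q) hρ n
  have h3 := weightedEnergy_nonneg_terms (q := q) hρ l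
  unfold weightedEnergy
  exact ⟨by linarith, by linarith, by linarith⟩

theorem IsStrongSolution.exists_weightedNorm_le {s : ℝ} (hs : 3 ≤ s) {T : EReal}
    {u₀ v₀ w₀ : ℝ → ℝ} {u v w : ℝ → ℝ → ℝ} (hsol : IsStrongSolution s T u₀ v₀ w₀ u v w)
    {lam : ℝ} (hlam : 0 ≤ lam) {T' : ℝ} (hT' : T' ∈ timeInterval T) :
    ∃ K : ℝ, 0 ≤ K ∧ ∀ p : ℝ, 1 ≤ p → ∀ C : ℝ,
      weightedNorm lam (2 * p) (potential u₀) (potential v₀) (potential w₀) ≤ ENNReal.ofReal C →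
      ∀ t ∈ Icc (0 : ℝ) T', weightedNorm lam (2 * p) (potential (u t)) (potential (v t))
        (potential (w t)) ≤ ENNReal.ofReal (K * C) := by
  obtain ⟨B, hB, hreg, hE⟩ := hsol.exists_energy_le hs hT'
  obtain ⟨⟨rfl, rfl, rfl⟩, -⟩ := hsol
  set a := 1 + lam
  have ha : 0 < a := by linarith
  set k := B * (11 + 3 * a)
  have hk : 0 ≤ k := by positivity
  -- One factor `3` comes from the three initial energies, via `3 ≤ 3 ^ q` before the root is taken;
  -- the other from adding three norms.
  refine ⟨9 * Real.exp (k * T'), by positivity, fun p hp C hC t ht => ?_⟩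
  have h0 : (0:ℝ) ∈ Icc 0 T' := ⟨le_rfl, hT'.1⟩
  set q := 2 * p
  have hq : 2 ≤ q := by linarith
  -- `ENNReal.ofReal` sends negative numbers to `0`, so a negative `C` may be replaced by `0`.
  set D := max C 0
  have hD : 0 ≤ D := le_max_right _ _
  have hCD : ENNReal.ofReal C = ENNReal.ofReal D := by simp [D, ENNReal.ofReal_max]
  rw [hCD] at hC
  unfold weightedNorm at hC
  set D' := 3 * (Real.exp (k * T') * D)
  have hD' : 0 ≤ D' := by positivity
  have hbound : ∀ N : ℕ, weightedEnergy q (fun x => Real.exp (q * tent a N x)) (potential (u t))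
      (potential (v t)) (potential (w t)) ≤ D' ^ q := fun N => by
    have hρ := energyWeight_exp_tent (q := q) (N := N) (by linarith) ha
    obtain ⟨ru, rv, rw_⟩ := hreg 0 h0
    have i1 := integral_abs_rpow_mul_tent_le (by linarith) ha.le hD
      ru.isPrimitive_potential.continuous ((le_self_add.trans le_self_add).trans hC) N
    have i2 := integral_abs_rpow_mul_tent_le (by linarith) ha.le hD
      rv.isPrimitive_potential.continuous ((le_add_self.trans le_self_add).trans hC) N
    have i3 := integral_abs_rpow_mul_tent_le (by linarith) ha.le hD
      rw_.isPrimitive_potential.continuous (le_add_self.trans hC) N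
    have hsum : weightedEnergy q (fun x => Real.exp (q * tent a N x)) (potential (u 0))
        (potential (v 0)) (potential (w 0)) ≤ 3 * D ^ q := by
      unfold weightedEnergy
      linarith
    have h3 : (3:ℝ) ≤ 3 ^ q := Real.self_le_rpow_of_one_le (by norm_num) (by linarith)
    calc _ ≤ Real.exp (q * k * t) * (3 * D ^ q) :=
          (hE q a hq ha.le _ hρ t ht).trans (mul_le_mul_of_nonneg_left hsum (Real.exp_pos _).le)
      _ ≤ Real.exp (k * T' * q) * (3 ^ q * D ^ q) := by
          have := mul_le_mul_of_nonneg_left ht.2 (mul_nonneg (by linarith : 0 ≤ q) hk)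
          exact mul_le_mul (Real.exp_le_exp.mpr (by linarith)) (mul_le_mul_of_nonneg_right h3 (by positivity))
            (by positivity) (Real.exp_pos _).le
      _ = D' ^ q := by
          rw [Real.mul_rpow (by norm_num) (by positivity), Real.mul_rpow (Real.exp_pos _).le hD,
            ← Real.exp_mul]
          ring
  obtain ⟨ru, rv, rw_⟩ := hreg t ht
  have key : ∀ f : ℝ → ℝ, RegularProfile B f → (∀ N : ℕ,
      ∫ x, |potential f x| ^ q * Real.exp (q * tent a N x) ≤ D' ^ q) →
      eLpNorm (fun x => potential f x * Real.exp (a * |x|)) (ENNReal.ofReal q) volume ≤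
        ENNReal.ofReal D' := fun f hf h =>
    eLpNorm_exp_le_of_forall_tent hq ha hD' hf.isPrimitive_potential.continuous
      hf.abs_potential_le h
  have hle := fun N : ℕ => le_weightedEnergy (q := q)
    (energyWeight_exp_tent (q := q) (N := N) (by linarith) ha) (potential (u t)) (potential (v t))
    (potential (w t))
  have ku := key _ ru fun N => (hle N).1.trans (hbound N)
  have kv := key _ rv fun N => (hle N).2.1.trans (hbound N)
  have kw := key _ rw_ fun N => (hle N).2.2.trans (hbound N)
  have hfin : ENNReal.ofReal (9 * Real.exp (k * T') * C) =
      ENNReal.ofReal D' + ENNReal.ofReal D' + ENNReal.ofReal D' := by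
    rw [ENNReal.ofReal_mul (by positivity), hCD, ← ENNReal.ofReal_mul (by positivity),
      ← ENNReal.ofReal_add hD' hD', ← ENNReal.ofReal_add (by positivity) hD']
    congr 1
    ring
  rw [hfin]
  exact add_le_add (add_le_add ku kv) kw

/-- At the critical rate `f e^{a|x|}` is merely bounded, perhaps in no `L^q`, so integrability must
come from the tent. Its gap below `a|x|`, times `q ≥ 2`, is at least `4|x| - 4N`; thus the integral
on the right is free of `q`. -/
theorem integral_abs_rpow_mul_tent_le_of_exp_decay {q a C N : ℝ} {f : ℝ → ℝ} (hq : 2 ≤ q)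
    (ha : 1 ≤ a) (hC : 0 ≤ C) (hf : ∀ x, |f x| ≤ C * Real.exp (-(a * |x|))) :
    ∫ x, |f x| ^ q * Real.exp (q * tent a N x) ≤
      C ^ q * ∫ x, Real.exp (4 * |N|) * Real.exp (-(4 * |x|)) := by
  have hint : Integrable fun x : ℝ => Real.exp (4 * |N|) * Real.exp (-(4 * |x|)) :=
    (integrable_exp_neg_mul_abs (by norm_num)).const_mul _
  rw [← integral_const_mul]
  refine integral_mono_of_nonneg (Filter.Eventually.of_forall fun x => by positivity)
    (hint.const_mul _) (Filter.Eventually.of_forall fun x => ?_)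
  have h1 : |f x| ^ q ≤ C ^ q * Real.exp (-(a * |x|) * q) := by
    rw [Real.exp_mul, ← Real.mul_rpow hC (Real.exp_pos _).le]
    exact Real.rpow_le_rpow (abs_nonneg _) (hf x) (by linarith)
  have h2 : -(a * |x|) * q + q * tent a N x ≤ 4 * |N| + -(4 * |x|) := by
    have e : -(a * |x|) * q + q * tent a N x = q * a * (min |x| (2 * N - |x|) - |x|) := by
      unfold tent; ring
    have m1 : min |x| (2 * N - |x|) - |x| ≤ 0 := sub_nonpos.mpr (min_le_left _ _)
    have m2 : min |x| (2 * N - |x|) - |x| ≤ 2 * N - |x| - |x| :=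
      sub_le_sub_right (min_le_right _ _) _
    have hqa : 2 ≤ q * a := by nlinarith
    have := le_abs_self N
    rw [e]
    nlinarith
  calc |f x| ^ q * Real.exp (q * tent a N x)
      ≤ C ^ q * Real.exp (-(a * |x|) * q) * Real.exp (q * tent a N x) := by gcongr
    _ = C ^ q * Real.exp (-(a * |x|) * q + q * tent a N x) := by rw [Real.exp_add]; ring
    _ ≤ C ^ q * Real.exp (4 * |N| + -(4 * |x|)) := by gcongr
    _ = _ := by rw [Real.exp_add]

theorem IsStrongSolution.exists_potential_exp_decay {s : ℝ} (hs : 3 ≤ s) {T : EReal}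
    {u₀ v₀ w₀ : ℝ → ℝ} {u v w : ℝ → ℝ → ℝ} (hsol : IsStrongSolution s T u₀ v₀ w₀ u v w)
    {a : ℝ} (ha : 1 ≤ a) {T' : ℝ} (hT' : T' ∈ timeInterval T)
    (hu₀ : ExpDecay a (potential u₀)) (hv₀ : ExpDecay a (potential v₀))
    (hw₀ : ExpDecay a (potential w₀)) :
    ∃ B C, 0 ≤ C ∧ ∀ t ∈ Icc 0 T', ∀ f ∈ ({u t, v t, w t} : Set (ℝ → ℝ)),
      RegularProfile B f ∧ ∀ x, |potential f x| ≤ C * Real.exp (-(a * |x|)) := by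
  obtain ⟨B, hB, hreg, hE⟩ := hsol.exists_energy_le hs hT'
  obtain ⟨⟨rfl, rfl, rfl⟩, -⟩ := hsol
  have ha0 : 0 < a := by linarith
  obtain ⟨ru, rv, rw_⟩ := hreg 0 ⟨le_rfl, hT'.1⟩
  obtain ⟨C₁, hC₁, h₁⟩ := hu₀.exists_bound ru.isPrimitive_potential.continuous
  obtain ⟨C₂, hC₂, h₂⟩ := hv₀.exists_bound rv.isPrimitive_potential.continuous
  obtain ⟨C₃, hC₃, h₃⟩ := hw₀.exists_bound rw_.isPrimitive_potential.continuous
  set C := C₁ + C₂ + C₃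
  have hC : 0 ≤ C := by positivity
  replace h₁ : ∀ x, |potential (u 0) x| ≤ C * Real.exp (-(a * |x|)) := fun x =>
    (h₁ x).trans (mul_le_mul_of_nonneg_right (by linarith) (Real.exp_pos _).le)
  replace h₂ : ∀ x, |potential (v 0) x| ≤ C * Real.exp (-(a * |x|)) := fun x =>
    (h₂ x).trans (mul_le_mul_of_nonneg_right (by linarith) (Real.exp_pos _).le)
  replace h₃ : ∀ x, |potential (w 0) x| ≤ C * Real.exp (-(a * |x|)) := fun x =>
    (h₃ x).trans (mul_le_mul_of_nonneg_right (by linarith) (Real.exp_pos _).le)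
  set k := B * (11 + 3 * a)
  have hk : 0 ≤ k := by positivity
  set A := Real.exp (k * T') * C
  have hA : 0 ≤ A := by positivity
  refine ⟨B, A, hA, fun t ht f hf => ?_⟩
  set D : ℝ → ℝ := fun N => ∫ x, Real.exp (4 * |N|) * Real.exp (-(4 * |x|))
  have hbound : ∀ q N : ℝ, 2 ≤ q → weightedEnergy q (fun x => Real.exp (q * tent a N x))
      (potential (u t)) (potential (v t)) (potential (w t)) ≤ A ^ q * (3 * D N) := by
    intro q N hq
    have hρ := energyWeight_exp_tent (q := q) (N := N) (by linarith) ha0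
    have i1 := integral_abs_rpow_mul_tent_le_of_exp_decay (N := N) hq ha hC h₁
    have i2 := integral_abs_rpow_mul_tent_le_of_exp_decay (N := N) hq ha hC h₂
    have i3 := integral_abs_rpow_mul_tent_le_of_exp_decay (N := N) hq ha hC h₃
    have hsum : weightedEnergy q (fun x => Real.exp (q * tent a N x)) (potential (u 0))
        (potential (v 0)) (potential (w 0)) ≤ 3 * (C ^ q * D N) := by
      unfold weightedEnergy
      linarith
    have hDN : 0 ≤ D N := integral_nonneg fun x => by positivity
    calc _ ≤ Real.exp (q * k * t) * (3 * (C ^ q * D N)) :=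
          (hE q a hq ha0.le _ hρ t ht).trans (mul_le_mul_of_nonneg_left hsum (Real.exp_pos _).le)
      _ ≤ Real.exp (k * T' * q) * (3 * (C ^ q * D N)) := by
          have := mul_le_mul_of_nonneg_left ht.2 (mul_nonneg (by linarith : 0 ≤ q) hk)
          exact mul_le_mul (Real.exp_le_exp.mpr (by linarith)) le_rfl
            (by positivity) (Real.exp_pos _).le
      _ = _ := by
          rw [Real.mul_rpow (Real.exp_pos _).le hC, ← Real.exp_mul]
          ring
  have hmem : RegularProfile B f ∧ ∀ q N : ℝ, 2 ≤ q →
      ∫ x, |potential f x| ^ q * Real.exp (q * tent a N x) ≤ A ^ q * (3 * D N) := by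
    obtain ⟨su, sv, sw⟩ := hreg t ht
    have hle := fun (q N : ℝ) (hq : 2 ≤ q) => le_weightedEnergy (q := q)
      (energyWeight_exp_tent (q := q) (N := N) (by linarith) ha0) (potential (u t))
      (potential (v t)) (potential (w t))
    rcases hf with rfl | rfl | rfl
    · exact ⟨su, fun q N hq => (hle q N hq).1.trans (hbound q N hq)⟩
    · exact ⟨sv, fun q N hq => (hle q N hq).2.1.trans (hbound q N hq)⟩
    · exact ⟨sw, fun q N hq => (hle q N hq).2.2.trans (hbound q N hq)⟩
  obtain ⟨hfr, hfE⟩ := hmem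
  refine ⟨hfr, fun x => ?_⟩
  have hfc := hfr.isPrimitive_potential.continuous
  have e : ∀ (n : ℕ) (y : ℝ), (|potential f y| * Real.exp (tent a |x| y)) ^ n =
      |potential f y| ^ (n : ℝ) * Real.exp (n * tent a |x| y) := fun n y => by
    rw [mul_pow, Real.rpow_natCast, Real.exp_nat_mul]
  -- With `N = |x|` the tent attains `a|x|` at the point `x` itself. The factor `3 * D |x|` may grow
  -- with `|x|`, but it does not enter the resulting bound `A`.
  have hpt := le_of_forall_integral_pow_le (D := 3 * D |x|)
    (g := fun y => |potential f y| * Real.exp (tent a |x| y)) (A := A)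
    (hfc.abs.mul (Real.continuous_exp.comp (lipschitzWith_tent ha0.le _).continuous))
    (fun y => by positivity) hA
    (fun n hn => by
      have hn' : (2:ℝ) ≤ n := by exact_mod_cast hn
      simp only [e]
      exact (energyWeight_exp_tent (by linarith) ha0).integrable_abs_rpow_mul hn' hfc
        hfr.abs_potential_le)
    (fun n hn => by
      have hn' : (2:ℝ) ≤ n := by exact_mod_cast hn
      simp only [e]
      rw [← Real.rpow_natCast A]
      exact hfE n |x| hn') x
  rw [tent_of_abs_le le_rfl] at hpt
  calc |potential f x| = |potential f x| * Real.exp (a * |x|) * Real.exp (-(a * |x|)) := by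
        rw [mul_assoc, ← Real.exp_add]; simp
    _ ≤ _ := by gcongr

theorem RegularProfile.iteratedDeriv_exp_decay {f : ℝ → ℝ} {a B C α : ℝ} (ha : 1 ≤ a)
    (hα : 0 < α) (hα1 : α < 1) (hC : 0 ≤ C) (hf : RegularProfile B f)
    (hm : ∀ x, |potential f x| ≤ C * Real.exp (-(a * |x|))) {j : ℕ} (hj : j ≤ 2) (x : ℝ) :
    |iteratedDeriv j f x| ≤ (2 * B + C / (1 - α) + C) * Real.exp (-(α * |x|)) := by
  have hm' : ∀ x, |potential f x| ≤ C * Real.exp (-(α * |x|)) := fun x => by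
    refine (hm x).trans ?_
    gcongr
    linarith
  obtain ⟨h0, h1⟩ := hf.exp_decay hα hα1 hC hm' x
  have hCe : 0 ≤ C * Real.exp (-(α * |x|)) := by positivity
  interval_cases j
  · rw [iteratedDeriv_zero]; linarith
  · rw [iteratedDeriv_one]; linarith
  · rw [iteratedDeriv_succ, iteratedDeriv_one]
    have e : deriv (deriv f) x = f x - potential f x := by unfold potential; ring
    rw [e]
    have := abs_sub (f x) (potential f x)
    have := hm' x
    linarith

theorem expDecay_potential {a : ℝ} {f : ℝ → ℝ} (h0 : ExpDecay a (iteratedDeriv 0 f))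
    (h2 : ExpDecay a (iteratedDeriv 2 f)) : ExpDecay a (potential f) := by
  have e : potential f = fun x => iteratedDeriv 0 f x - iteratedDeriv 2 f x := by
    funext x
    rw [iteratedDeriv_zero, iteratedDeriv_succ, iteratedDeriv_one, potential]
  rw [e]
  exact h0.sub h2

end ThreeCH

end

theorem theorem3p2 (s : ℝ) (hs : 3 ≤ s) (T : EReal) (hT : 0 < T)
    (u₀ v₀ w₀ : ℝ → ℝ) (u v w : ℝ → ℝ → ℝ)
    (hsol : ThreeCH.IsStrongSolution s T u₀ v₀ w₀ u v w)
    (lam : ℝ) (hlam : 0 ≤ lam) :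
    (∀ T' : ℝ, T' ∈ ThreeCH.timeInterval T → ∃ K : ℝ, 0 ≤ K ∧
      ∀ p : ℝ, 1 ≤ p → ∀ C : ℝ,
        ThreeCH.weightedNorm lam (2 * p) (ThreeCH.potential u₀) (ThreeCH.potential v₀)
          (ThreeCH.potential w₀) ≤ ENNReal.ofReal C →
        ∀ t ∈ Set.Icc (0 : ℝ) T',
          ThreeCH.weightedNorm lam (2 * p) (ThreeCH.potential (u t)) (ThreeCH.potential (v t))
            (ThreeCH.potential (w t)) ≤ ENNReal.ofReal (K * C)) ∧
    ((∀ j : ℕ, j ≤ 2 →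
        ThreeCH.ExpDecay (1 + lam) (iteratedDeriv j u₀) ∧
        ThreeCH.ExpDecay (1 + lam) (iteratedDeriv j v₀) ∧
        ThreeCH.ExpDecay (1 + lam) (iteratedDeriv j w₀)) →
      ∀ T' : ℝ, T' ∈ ThreeCH.timeInterval T →
        (ThreeCH.UniformExpDecay (1 + lam) T' (fun t => ThreeCH.potential (u t)) ∧
         ThreeCH.UniformExpDecay (1 + lam) T' (fun t => ThreeCH.potential (v t)) ∧
         ThreeCH.UniformExpDecay (1 + lam) T' (fun t => ThreeCH.potential (w t))) ∧
        ∀ α : ℝ, 0 < α → α < 1 → ∀ j : ℕ, j ≤ 2 →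
          ThreeCH.UniformExpDecay α T' (fun t => iteratedDeriv j (u t)) ∧
          ThreeCH.UniformExpDecay α T' (fun t => iteratedDeriv j (v t)) ∧
          ThreeCH.UniformExpDecay α T' (fun t => iteratedDeriv j (w t))) := by
  refine ⟨fun T' hT' => hsol.exists_weightedNorm_le hs hlam hT', fun hdecay T' hT' => ?_⟩
  obtain ⟨d0u, d0v, d0w⟩ := hdecay 0 (by norm_num)
  obtain ⟨d2u, d2v, d2w⟩ := hdecay 2 le_rfl
  have ha : 1 ≤ 1 + lam := by linarith
  obtain ⟨B, C, hC, h⟩ := hsol.exists_potential_exp_decay hs ha hT'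
    (ThreeCH.expDecay_potential d0u d2u) (ThreeCH.expDecay_potential d0v d2v)
    (ThreeCH.expDecay_potential d0w d2w)
  refine ⟨⟨?_, ?_, ?_⟩, fun α hα hα1 j hj => ⟨?_, ?_, ?_⟩⟩
  · exact ThreeCH.uniformExpDecay_of_forall_le fun t ht => (h t ht (u t) (by simp)).2
  · exact ThreeCH.uniformExpDecay_of_forall_le fun t ht => (h t ht (v t) (by simp)).2
  · exact ThreeCH.uniformExpDecay_of_forall_le fun t ht => (h t ht (w t) (by simp)).2
  · exact ThreeCH.uniformExpDecay_of_forall_le fun t ht x =>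
      (h t ht (u t) (by simp)).1.iteratedDeriv_exp_decay ha hα hα1 hC
        (h t ht (u t) (by simp)).2 hj x
  · exact ThreeCH.uniformExpDecay_of_forall_le fun t ht x =>
      (h t ht (v t) (by simp)).1.iteratedDeriv_exp_decay ha hα hα1 hC
        (h t ht (v t) (by simp)).2 hj x
  · exact ThreeCH.uniformExpDecay_of_forall_le fun t ht x =>
      (h t ht (w t) (by simp)).1.iteratedDeriv_exp_decay ha hα hα1 hC
        (h t ht (w t) (by simp)).2 hj x
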